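/- (Proposition) Let $\mathcal H$ be a separable infinite-dimensional Hilbert space, $\mathcal K=\mathcal K(\mathcal H)$ the compact operators, $Y$ a compact Hausdorff space (in particular, any finite-dimensional compact metric space), and $m\in\mathbb Z\setminus\{0\}$. Let $S$ be the left shift on $\ell^2(\mathbb N)$, let $p_{ij}$ be the matrix units of $\mathcal K(\ell^2(\mathbb N))$, and read $(S^*)^m$ as $S^{-m}$ for $m<0$. For a unital $C^*$-algebra $A$, the $m$-torsioned quantum double suspension $\Sigma^2_mA$ is the $C^*$-algebra of operators generated by $A\otimes\mathcal K(\ell^2(\mathbb N))$ and $1\otimes(S^*)^m$, where $A$ is represented faithfully and unitally on a Hilbert space (for instance by its universal representation). Put $M(Y)=M(C(Y)\otimes\mathcal K)$, identified with the $*$-strongly continuous functions $Y\to\mathcal L(\mathcal H)$, and $Q(Y)=M(Y)/(C(Y)\otimes\mathcal K)$; for $x\in M(Y)$ let $[x]$ be its class in $Q(Y)$. Let $A$ and $B$ be unital $C^*$-algebras and let $$\xi:\ 0\longrightarrow C(Y)\otimes\mathcal K\xrightarrow{\ \iota\ }B\xrightarrow{\ \alpha\ }A\longrightarrow 0$$ be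 an extension with Busby invariant $\tau:A\to Q(Y)$. Then there is an extension $$\Sigma^2_m\xi:\ 0\longrightarrow C(Y)\otimes\mathcal K\otimes\mathcal K(\ell^2(\mathbb N))\xrightarrow{\ \Sigma^2_m\iota\ }\Sigma^2_mB\xrightarrow{\ \Sigma^2_m\alpha\ }\Sigma^2_mA\longrightarrow 0,$$ where $\Sigma^2_m\iota(f\otimes p_{ij})=\iota(f)\otimes p_{ij}$, and $\Sigma^2_m\alpha$ is the $*$-homomorphism with $\Sigma^2_m\alpha(b\otimes p_{ij})=\alpha(b)\otimes p_{ij}$ and $\Sigma^2_m\alpha(1\otimes(S^*)^m)=1\otimes(S^*)^m$. Its Busby invariant is $\Sigma^2_m\tau$, the $*$-homomorphism $\Sigma^2_mA\to Q\big(C(Y)\otimes\mathcal K\otimes\mathcal K(\ell^2(\mathbb N))\big)$ with $\Sigma^2_m\tau(a\otimes p_{ij})=[x\otimes p_{ij}]$ whenever $x\in M(Y)$ and $[x]=\tau(a)$, and $\Sigma^2_m\tau(1\otimes(S^*)^m)=[1\otimes1\otimes(S^*)^m]$. Moreover, if $\xi$ is homogeneous, that is, if $\mathrm{ev}_y\circ\tau:A\to\mathcal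 L(\mathcal H)/\mathcal K(\mathcal H)$ is injective for every $y\in Y$, then $\Sigma^2_m\xi$ is homogeneous, in the same sense with $\mathcal H\otimes\ell^2(\mathbb N)$ in place of $\mathcal H$. -/

import Mathlib

open scoped ENNReal ComplexOrder InnerProductSpace

set_option linter.unusedSectionVars false

noncomputable section

namespace QDS

section Operators

variable (H : Type*) [NormedAddCommGroup H] [InnerProductSpace ℂ H]

/-- The Hilbert space `H ⊗ ℓ²(ℕ)`, as the space of square summable sequences in `H`. -/
abbrev Seq : Type _ := lp (fun _ : ℕ => H) 2

/-- The left shift `1 ⊗ S` on `H ⊗ ℓ²(ℕ)`: `(x₀, x₁, x₂, …) ↦ (x₁, x₂, …)`. -/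
def leftShift : Seq H →L[ℂ] Seq H :=
  LinearMap.mkContinuous
    { toFun := fun x => ⟨fun n => x (n + 1), by
        have hx := (lp.memℓp x).summable (by norm_num)
        exact memℓp_gen ((summable_nat_add_iff 1).2 hx)⟩
      map_add' := fun _ _ => rfl
      map_smul' := fun _ _ => rfl } 1 (by
    intro x
    rw [one_mul]
    have hx := (lp.memℓp x).summable (p := 2) (by norm_num)
    refine lp.norm_le_of_tsum_le (by norm_num) (norm_nonneg _) ?_
    rw [lp.norm_rpow_eq_tsum (by norm_num) x, hx.tsum_eq_zero_add]
    exact le_add_of_nonneg_left (by positivity))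

variable {H}

/-- The operator `T ⊗ p_{ij}` on `H ⊗ ℓ²(ℕ)`: `x ↦ (T x_j) ⊗ e_i`. -/
def unitOp (T : H →L[ℂ] H) (i j : ℕ) : Seq H →L[ℂ] Seq H :=
  lp.singleContinuousLinearMap ℂ (fun _ : ℕ => H) 2 i ∘L T ∘L lp.evalCLM ℂ (fun _ : ℕ => H) 2 j

theorem unitOp_apply (T : H →L[ℂ] H) (i j : ℕ) (x : Seq H) :
    unitOp T i j x = lp.single 2 i (T (x j)) := rfl

theorem leftShift_apply (x : Seq H) (n : ℕ) : leftShift H x n = x (n + 1) := rfl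

theorem isCompactOperator_unitOp {T : H →L[ℂ] H} (hT : IsCompactOperator T) (i j : ℕ) :
    IsCompactOperator (unitOp T i j) :=
  (hT.comp_clm (lp.evalCLM ℂ (fun _ : ℕ => H) 2 j)).clm_comp
    (lp.singleContinuousLinearMap ℂ (fun _ : ℕ => H) 2 i)

variable [CompleteSpace H]

theorem star_unitOp (T : H →L[ℂ] H) (i j : ℕ) : star (unitOp T i j) = unitOp (star T) j i := by
  symm
  refine (ContinuousLinearMap.eq_adjoint_iff _ _).2 fun x y => ?_
  simp only [unitOp_apply, lp.inner_single_left, lp.inner_single_right,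
    ContinuousLinearMap.star_eq_adjoint, ContinuousLinearMap.adjoint_inner_left]

variable (H) in
/-- The operator `1 ⊗ (S*)^m` on `H ⊗ ℓ²(ℕ)`, where `(S*)^m` means `S^{-m}` for `m < 0`. -/
def shiftPow (m : ℤ) : Seq H →L[ℂ] Seq H :=
  if 0 ≤ m then star (leftShift H) ^ m.toNat else leftShift H ^ (-m).toNat

theorem isCompactOperator_star {T : H →L[ℂ] H} (hT : IsCompactOperator T) :
    IsCompactOperator (star T : H →L[ℂ] H) := by
  have h1 : IsCompactOperator ((T ∘L star T : H →L[ℂ] H) : H →ₗ[ℂ] H) := hT.comp_clm _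
  change IsCompactOperator ((star T : H →L[ℂ] H) : H →ₗ[ℂ] H)
  rw [isCompactOperator_iff_isCompact_closure_image_ball _ zero_lt_one]
  have h2 := (h1.isCompact_closure_image_ball 1).totallyBounded.subset subset_closure
  refine TotallyBounded.isCompact_of_isClosed (TotallyBounded.closure ?_) isClosed_closure
  rw [Metric.totallyBounded_iff]
  intro ε hε
  obtain ⟨t, hts, htf, ht⟩ := Metric.finite_approx_of_totallyBounded h2 (ε ^ 2 / 2) (by positivity)
  have hch : ∀ z ∈ t, ∃ x ∈ Metric.ball (0 : H) 1, T (star T x) = z := fun z hz => hts hz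
  choose! g hg using hch
  refine ⟨(fun z => star T (g z)) '' t, htf.image _, ?_⟩
  rintro _ ⟨x, hx, rfl⟩
  obtain ⟨z, hz, hxz⟩ := Set.mem_iUnion₂.1 (ht ⟨x, hx, rfl⟩)
  refine Set.mem_iUnion₂.2 ⟨_, ⟨z, hz, rfl⟩, ?_⟩
  have hgz := hg z hz
  rw [Metric.mem_ball, dist_eq_norm] at hxz ⊢
  change ‖star T x - star T (g z)‖ < ε
  change ‖T (star T x) - z‖ < _ at hxz
  rw [← hgz.2, ← map_sub, ← map_sub] at hxz
  rw [← map_sub]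
  set d := x - g z with hd
  have hd2 : ‖d‖ ≤ 2 := by
    have h3 : ‖x‖ < 1 := by simpa using hx
    have h4 : ‖g z‖ < 1 := by simpa using hgz.1
    linarith [norm_sub_le x (g z)]
  have h5 : ‖star T d‖ ^ 2 ≤ ‖T (star T d)‖ * ‖d‖ := by
    have h6 : inner ℂ (T (star T d)) d = inner ℂ (star T d) (star T d) := by
      rw [ContinuousLinearMap.star_eq_adjoint, ContinuousLinearMap.adjoint_inner_right]
    have h7 := norm_inner_le_norm (𝕜 := ℂ) (T (star T d)) d
    rw [h6, inner_self_eq_norm_sq_to_K] at h7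
    simpa using h7
  have h8 : ‖star T d‖ ^ 2 < ε ^ 2 := by
    nlinarith [norm_nonneg (T (star T d)), norm_nonneg d]
  exact lt_of_pow_lt_pow_left₀ 2 hε.le h8

theorem isCompactOperator_rankOne (v w : H) :
    IsCompactOperator (InnerProductSpace.rankOne ℂ v w : H →L[ℂ] H) := by
  have h : IsCompactOperator (innerSL ℂ w : H →L[ℂ] ℂ) :=
    isCompactOperator_of_locallyCompactSpace_dom _
  exact h.clm_comp (ContinuousLinearMap.toSpanSingleton ℂ v)

variable (H) in
/-- The C*-algebra `K(H)` of compact operators on `H`. -/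
def Cpt : NonUnitalStarSubalgebra ℂ (H →L[ℂ] H) where
  carrier := {T | IsCompactOperator T}
  add_mem' := fun ha hb => ha.add hb
  zero_mem' := isCompactOperator_zero
  mul_mem' := fun {_ b} ha _ => ha.comp_clm b
  smul_mem' := fun c _ ha => ha.smul c
  star_mem' := fun ha => isCompactOperator_star ha

instance : IsClosed (Cpt H : Set (H →L[ℂ] H)) := isClosed_setOfPred_isCompactOperator

end Operators

section StarQuotient

variable {R : Type*} [Ring R] [StarRing R] (I : Ideal R) [I.IsTwoSided]

/-- The involution of the quotient of a *-ring by a self-adjoint two-sided ideal. -/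
abbrev starQuotient (hI : ∀ x ∈ I, star x ∈ I) : StarRing (R ⧸ I) where
  star := Quotient.map' star (by
    intro a b hab
    rw [Submodule.quotientRel_def] at hab ⊢
    simpa using hI _ hab)
  star_involutive := by
    intro a
    obtain ⟨a, rfl⟩ := Ideal.Quotient.mk_surjective a
    exact congrArg (Ideal.Quotient.mk I) (star_star a)
  star_mul := by
    intro a b
    obtain ⟨a, rfl⟩ := Ideal.Quotient.mk_surjective a
    obtain ⟨b, rfl⟩ := Ideal.Quotient.mk_surjective b
    exact congrArg (Ideal.Quotient.mk I) (star_mul a b)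
  star_add := by
    intro a b
    obtain ⟨a, rfl⟩ := Ideal.Quotient.mk_surjective a
    obtain ⟨b, rfl⟩ := Ideal.Quotient.mk_surjective b
    exact congrArg (Ideal.Quotient.mk I) (star_add a b)

end StarQuotient

section Corona

variable (Y : Type*) [TopologicalSpace Y] [CompactSpace Y]
variable (H : Type*) [NormedAddCommGroup H] [InnerProductSpace ℂ H] [CompleteSpace H]

variable {Y H} in
theorem exists_bound {x : Y → H →L[ℂ] H} (hx : ∀ v, Continuous fun y => x y v) :
    ∃ C, ∀ y, ‖x y‖ ≤ C := by
  refine banach_steinhaus fun v => ?_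
  obtain ⟨C, hC⟩ := (isCompact_range (hx v)).isBounded.exists_norm_le
  exact ⟨C, fun y => hC _ ⟨y, rfl⟩⟩

variable {Y H} in
theorem continuous_apply_of_bound {x : Y → H →L[ℂ] H} (hx : ∀ v, Continuous fun y => x y v)
    {w : Y → H} (hw : Continuous w) : Continuous fun y => x y (w y) := by
  obtain ⟨C, hC⟩ := exists_bound hx
  rw [continuous_iff_continuousAt]
  intro y₀
  have h1 : Filter.Tendsto (fun y => x y (w y - w y₀)) (nhds y₀) (nhds 0) := by
    refine squeeze_zero_norm (a := fun y => C * ‖w y - w y₀‖)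
      (fun y => (x y).le_of_opNorm_le (hC y) _) ?_
    have : Continuous fun y => C * ‖w y - w y₀‖ := by fun_prop
    simpa using this.tendsto y₀
  have h2 := h1.add ((hx (w y₀)).tendsto y₀)
  simpa [ContinuousAt] using h2

/-- `M(Y) = M(C(Y) ⊗ K(H))`: the *-strongly continuous functions from `Y` to `L(H)`, with
the pointwise operations. -/
def Mult : StarSubalgebra ℂ (Y → H →L[ℂ] H) where
  carrier := {x | (∀ v, Continuous fun y => x y v) ∧ ∀ v, Continuous fun y => star (x y) v}
  add_mem' := by
    intro a b ha hb
    refine ⟨fun v => (ha.1 v).add (hb.1 v), fun v => ?_⟩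
    simp only [Pi.add_apply, star_add, add_apply]
    exact (ha.2 v).add (hb.2 v)
  mul_mem' := by
    intro a b ha hb
    refine ⟨fun v => continuous_apply_of_bound ha.1 (hb.1 v), fun v => ?_⟩
    simpa using continuous_apply_of_bound hb.2 (ha.2 v)
  algebraMap_mem' := by
    intro r
    refine ⟨fun v => continuous_const, fun v => ?_⟩
    exact continuous_const (y := star (algebraMap ℂ (H →L[ℂ] H) r) v)
  star_mem' := by
    intro a ha
    exact ⟨ha.2, fun v => by simpa using ha.1 v⟩

instance : Ring (Mult Y H) := inferInstance

instance : StarRing (Mult Y H) := inferInstance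

instance : Algebra ℂ (Mult Y H) := inferInstance

variable {Y H}

theorem continuous_comp_cpt {x : Y → H →L[ℂ] H} (hx : ∀ v, Continuous fun y => x y v)
    {k : Y → H →L[ℂ] H} (hk : Continuous k) (hk' : ∀ y, IsCompactOperator (k y)) :
    Continuous fun y => x y ∘L k y := by
  obtain ⟨C, hC⟩ := exists_bound hx
  rw [continuous_iff_continuousAt]
  intro y₀
  have hC0 : 0 ≤ C := (norm_nonneg _).trans (hC y₀)
  have h1 : Filter.Tendsto (fun y => x y ∘L (k y - k y₀)) (nhds y₀) (nhds 0) := by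
    refine squeeze_zero_norm (a := fun y => C * ‖k y - k y₀‖) (fun y => ?_) ?_
    · exact (ContinuousLinearMap.opNorm_comp_le _ _).trans
        (mul_le_mul_of_nonneg_right (hC y) (norm_nonneg _))
    have : Continuous fun y => C * ‖k y - k y₀‖ := by fun_prop
    simpa using this.tendsto y₀
  have h2 : Filter.Tendsto (fun y => x y ∘L k y₀) (nhds y₀) (nhds (x y₀ ∘L k y₀)) := by
    rw [Metric.tendsto_nhds]
    intro ε hε
    have hcpt : IsCompactOperator ((k y₀ : H →L[ℂ] H) : H →ₗ[ℂ] H) := hk' y₀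
    have htb := (hcpt.isCompact_closure_image_closedBall 1).totallyBounded.subset subset_closure
    set δ : ℝ := ε / (8 * (C + 1)) with hδ
    have hδ0 : 0 < δ := by positivity
    obtain ⟨t, -, htf, ht⟩ := Metric.finite_approx_of_totallyBounded htb δ hδ0
    have hev : ∀ᶠ y in nhds y₀, ∀ v ∈ t, dist (x y v) (x y₀ v) < ε / 4 :=
      (Filter.eventually_all_finite htf).2 fun v _ =>
        Metric.tendsto_nhds.1 ((hx v).tendsto y₀) _ (by positivity)
    filter_upwards [hev] with y hy
    rw [dist_eq_norm]
    refine lt_of_le_of_lt (?_ : _ ≤ ε / 2) (by linarith)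
    refine ContinuousLinearMap.opNorm_le_of_unit_norm (𝕜 := ℂ) (by positivity) fun u hu => ?_
    obtain ⟨v, hv, huv⟩ := Set.mem_iUnion₂.1 (ht ⟨u, by simp [hu], rfl⟩)
    have huv' : ‖k y₀ u - v‖ < δ := by rwa [Metric.mem_ball, dist_eq_norm] at huv
    have h3 : x y (k y₀ u) - x y₀ (k y₀ u)
        = x y (k y₀ u - v) - x y₀ (k y₀ u - v) + (x y v - x y₀ v) := by
      simp only [map_sub]; abel
    have h4 := (x y).le_of_opNorm_le (hC y) (k y₀ u - v)
    have h5 := (x y₀).le_of_opNorm_le (hC y₀) (k y₀ u - v)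
    have h6 : ‖x y v - x y₀ v‖ < ε / 4 := by rw [← dist_eq_norm]; exact hy v hv
    have h7 : C * ‖k y₀ u - v‖ ≤ ε / 8 := by
      have : C * ‖k y₀ u - v‖ ≤ (C + 1) * δ := by
        apply mul_le_mul _ huv'.le (norm_nonneg _) (by positivity)
        linarith
      refine this.trans (le_of_eq ?_)
      rw [hδ]; field_simp
    change ‖x y (k y₀ u) - x y₀ (k y₀ u)‖ ≤ _
    rw [h3]
    have h8 := norm_add_le (x y (k y₀ u - v) - x y₀ (k y₀ u - v)) (x y v - x y₀ v)
    have h9 := norm_sub_le (x y (k y₀ u - v)) (x y₀ (k y₀ u - v))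
    linarith
  have h3 := h1.add h2
  simpa [ContinuousAt, ContinuousLinearMap.comp_sub] using h3

variable (Y H) in
/-- The C*-algebra `C(Y) ⊗ K(H) = C(Y, K(H))` of norm continuous functions `Y → K(H)`. -/
def CptFun : Type _ := C(Y, Cpt H)

instance : NonUnitalCStarAlgebra (CptFun Y H) := inferInstanceAs (NonUnitalCStarAlgebra C(Y, Cpt H))

/-- A norm continuous function with compact values, as an element of `C(Y) ⊗ K(H)`. -/
def CptFun.mk (k : Y → H →L[ℂ] H) (hk : Continuous k) (hk' : ∀ y, IsCompactOperator (k y)) :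
    CptFun Y H :=
  (⟨fun y => ⟨k y, hk' y⟩, hk.subtype_mk _⟩ : C(Y, Cpt H))

/-- The value at `y`. -/
def CptFun.val (f : CptFun Y H) (y : Y) : H →L[ℂ] H := ((show C(Y, Cpt H) from f) y : H →L[ℂ] H)

theorem CptFun.continuous_val (f : CptFun Y H) : Continuous f.val :=
  continuous_subtype_val.comp (show C(Y, Cpt H) from f).continuous

theorem CptFun.isCompactOperator_val (f : CptFun Y H) (y : Y) : IsCompactOperator (f.val y) :=
  ((show C(Y, Cpt H) from f) y).2

@[simp] theorem CptFun.val_mk (k : Y → H →L[ℂ] H) (hk hk') : (CptFun.mk k hk hk').val = k := rfl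

theorem CptFun.ext {f g : CptFun Y H} (h : f.val = g.val) : f = g :=
  ContinuousMap.ext fun y => Subtype.ext (congrFun h y)

theorem CptFun.norm_val_le (f : CptFun Y H) (y : Y) : ‖f.val y‖ ≤ ‖f‖ :=
  ContinuousMap.norm_coe_le_norm (show C(Y, Cpt H) from f) y

theorem CptFun.norm_le {f : CptFun Y H} {C : ℝ} (hC : 0 ≤ C) (h : ∀ y, ‖f.val y‖ ≤ C) :
    ‖f‖ ≤ C :=
  (ContinuousMap.norm_le (show C(Y, Cpt H) from f) hC).2 h

/-- The inclusion of `C(Y) ⊗ K(H)` into `M(Y)`. -/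
def toMult : CptFun Y H →⋆ₙₐ[ℂ] Mult Y H where
  toFun f := ⟨f.val, fun _ => f.continuous_val.clm_apply continuous_const,
      fun _ => (continuous_star.comp f.continuous_val).clm_apply continuous_const⟩
  map_smul' _ _ := rfl
  map_zero' := rfl
  map_add' _ _ := rfl
  map_mul' _ _ := rfl
  map_star' _ := rfl

theorem coe_toMult (f : CptFun Y H) : (toMult f : Y → H →L[ℂ] H) = f.val := rfl

theorem toMult_injective : Function.Injective (toMult : CptFun Y H → Mult Y H) :=
  fun _ _ h => CptFun.ext (congrArg Subtype.val h)

theorem exists_toMult_mul (x : Mult Y H) (f : CptFun Y H) :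
    ∃ g : CptFun Y H, toMult g = x * toMult f :=
  ⟨CptFun.mk (fun y => (x : Y → H →L[ℂ] H) y ∘L f.val y)
    (continuous_comp_cpt x.2.1 f.continuous_val f.isCompactOperator_val)
    fun y => (f.isCompactOperator_val y).clm_comp _, rfl⟩

theorem exists_mul_toMult (x : Mult Y H) (f : CptFun Y H) :
    ∃ g : CptFun Y H, toMult g = toMult f * x := by
  obtain ⟨g, hg⟩ := exists_toMult_mul (star x) (star f)
  refine ⟨star g, ?_⟩
  rw [map_star, hg, map_star, star_mul, star_star, star_star]

variable (Y H) in
/-- `C(Y) ⊗ K(H)` as an ideal of `M(Y)`. -/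
def coronaIdeal : Ideal (Mult Y H) where
  carrier := Set.range (toMult : CptFun Y H → Mult Y H)
  add_mem' := by
    rintro _ _ ⟨f, rfl⟩ ⟨g, rfl⟩
    exact ⟨f + g, map_add _ _ _⟩
  zero_mem' := ⟨0, map_zero _⟩
  smul_mem' := by
    rintro x _ ⟨f, rfl⟩
    exact exists_toMult_mul x f

instance : (coronaIdeal Y H).IsTwoSided where
  mul_mem_of_left := by
    rintro _ x ⟨f, rfl⟩
    exact exists_mul_toMult x f

variable (Y H) in
/-- The corona algebra `Q(Y) = M(C(Y) ⊗ K(H)) / (C(Y) ⊗ K(H))`. -/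
def Corona : Type _ := Mult Y H ⧸ coronaIdeal Y H

instance : Ring (Corona Y H) := Ideal.Quotient.ring (coronaIdeal Y H)

instance : Algebra ℂ (Corona Y H) := inferInstanceAs (Algebra ℂ (Mult Y H ⧸ coronaIdeal Y H))

instance : StarRing (Corona Y H) :=
  starQuotient (coronaIdeal Y H) (by rintro _ ⟨f, rfl⟩; exact ⟨star f, map_star _ _⟩)

/-- The quotient map `M(Y) → Q(Y)`. -/
def toCorona : Mult Y H →⋆ₐ[ℂ] Corona Y H where
  __ := Ideal.Quotient.mkₐ ℂ (coronaIdeal Y H)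
  map_star' _ := rfl

theorem toCorona_surjective : Function.Surjective (toCorona : Mult Y H → Corona Y H) :=
  Ideal.Quotient.mk_surjective

theorem toCorona_eq_zero {x : Mult Y H} : toCorona x = 0 ↔ ∃ f : CptFun Y H, toMult f = x :=
  Ideal.Quotient.eq_zero_iff_mem

variable (H) in
/-- The ideal `K(H)` of `L(H)`. -/
def cptIdeal : Ideal (H →L[ℂ] H) where
  carrier := {T | IsCompactOperator T}
  add_mem' := fun ha hb => ha.add hb
  zero_mem' := isCompactOperator_zero
  smul_mem' := fun c _ ha => ha.clm_comp c

instance : (cptIdeal H).IsTwoSided where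
  mul_mem_of_left := fun b ha => IsCompactOperator.comp_clm ha b

variable (H) in
/-- The Calkin algebra `Q = L(H) / K(H)`. -/
def Calkin : Type _ := (H →L[ℂ] H) ⧸ cptIdeal H

instance : Ring (Calkin H) := inferInstanceAs (Ring ((H →L[ℂ] H) ⧸ cptIdeal H))

instance : Algebra ℂ (Calkin H) := inferInstanceAs (Algebra ℂ ((H →L[ℂ] H) ⧸ cptIdeal H))

instance : StarRing (Calkin H) :=
  starQuotient (cptIdeal H) fun _ hx => isCompactOperator_star hx

/-- The evaluation map `ev_y : Q(Y) → Q`, induced by evaluation of functions at `y`. -/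
def evCorona (y : Y) : Corona Y H →⋆ₐ[ℂ] Calkin H where
  __ := Ideal.Quotient.liftₐ (coronaIdeal Y H)
    ((Ideal.Quotient.mkₐ ℂ (cptIdeal H)).comp
      ((Pi.evalAlgHom ℂ (fun _ : Y => H →L[ℂ] H) y).comp (Mult Y H).subtype.toAlgHom)) (by
      rintro _ ⟨f, rfl⟩
      exact Ideal.Quotient.eq_zero_iff_mem.2 (f.isCompactOperator_val y))
  map_star' x := by
    obtain ⟨x, rfl⟩ := toCorona_surjective x
    rfl

theorem evCorona_toCorona (y : Y) (x : Mult Y H) :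
    evCorona y (toCorona x) = Ideal.Quotient.mk (cptIdeal H) ((x : Y → H →L[ℂ] H) y) := rfl

/-- An element of `M(Y)` is determined by its left action on `C(Y) ⊗ K(H)`. -/
theorem mult_ext {x x' : Mult Y H} (h : ∀ f : CptFun Y H, x * toMult f = x' * toMult f) :
    x = x' := by
  refine Subtype.ext (funext fun y => ContinuousLinearMap.ext fun v => ?_)
  by_cases hv : v = 0
  · simp [hv]
  have hc : IsCompactOperator (InnerProductSpace.rankOne ℂ v v : H →L[ℂ] H) :=
    isCompactOperator_rankOne v v
  have h1 := congrArg (fun z : Mult Y H => (z : Y → H →L[ℂ] H) y v)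
    (h (CptFun.mk (fun _ => _) continuous_const fun _ => hc))
  have h2 : inner ℂ v v • (x : Y → H →L[ℂ] H) y v = inner ℂ v v • (x' : Y → H →L[ℂ] H) y v := by
    simpa [coe_toMult] using h1
  exact smul_right_injective H (inner_self_ne_zero.2 hv) h2

/-- A bounded linear map on `C(Y) ⊗ K(H)` that is one half of a double centralizer is left
multiplication by an element of `M(Y)`. -/
theorem exists_mult (L R : CptFun Y H → CptFun Y H) (hadd : ∀ f g, L (f + g) = L f + L g)
    (hsmul : ∀ (c : ℂ) f, L (c • f) = c • L f) (C : ℝ) (hC : ∀ f, ‖L f‖ ≤ C * ‖f‖)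
    (hLR : ∀ f g, f * L g = R f * g) :
    ∃ x : Mult Y H, ∀ f, toMult (L f) = x * toMult f := by
  rcases subsingleton_or_nontrivial H with hH | hH
  · exact ⟨0, fun f => Subtype.ext (funext fun y => Subsingleton.elim _ _)⟩
  obtain ⟨e, he⟩ := exists_norm_eq H zero_le_one
  have hee : inner ℂ e e = (1 : ℂ) := by simp [inner_self_eq_norm_sq_to_K, he]
  let rk : H → CptFun Y H := fun v =>
    CptFun.mk (fun _ => InnerProductSpace.rankOne ℂ v e) continuous_const
      fun _ => isCompactOperator_rankOne v e
  have rk_apply : ∀ v y u, (rk v).val y u = inner ℂ e u • v := fun v y u =>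
    InnerProductSpace.rankOne_apply v e u
  have rk_star : ∀ v y u, (star (rk v)).val y u = inner ℂ v u • e := by
    intro v y u
    change (star (InnerProductSpace.rankOne ℂ v e : H →L[ℂ] H)) u = _
    rw [ContinuousLinearMap.star_eq_adjoint, InnerProductSpace.adjoint_rankOne]
    exact InnerProductSpace.rankOne_apply e v u
  have rk_add : ∀ v w, rk (v + w) = rk v + rk w := by
    intro v w
    refine CptFun.ext (funext fun y => ContinuousLinearMap.ext fun u => ?_)
    change (rk (v + w)).val y u = (rk v).val y u + (rk w).val y u
    simp only [rk_apply, smul_add]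
  have rk_smul : ∀ (c : ℂ) v, rk (c • v) = c • rk v := by
    intro c v
    refine CptFun.ext (funext fun y => ContinuousLinearMap.ext fun u => ?_)
    change (rk (c • v)).val y u = c • (rk v).val y u
    simp only [rk_apply, smul_comm c]
  have rk_norm : ∀ v, ‖rk v‖ ≤ ‖v‖ := by
    intro v
    refine CptFun.norm_le (norm_nonneg _) fun y => ?_
    refine ContinuousLinearMap.opNorm_le_bound _ (norm_nonneg _) fun u => ?_
    rw [rk_apply, norm_smul]
    have := norm_inner_le_norm (𝕜 := ℂ) e u
    rw [he, one_mul] at this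
    nlinarith [norm_nonneg v]
  let X : Y → H →L[ℂ] H := fun y => LinearMap.mkContinuous
    { toFun := fun v => (L (rk v)).val y e
      map_add' := fun v w => by rw [rk_add, hadd]; rfl
      map_smul' := fun c v => by rw [rk_smul, hsmul]; rfl } |C| (by
    intro v
    have h1 := ((L (rk v)).val y).le_opNorm e
    have h2 := (L (rk v)).norm_val_le y
    have h3 := hC (rk v)
    have h4 : C * ‖rk v‖ ≤ |C| * ‖v‖ :=
      mul_le_mul (le_abs_self C) (rk_norm v) (norm_nonneg _) (abs_nonneg C)
    rw [he, mul_one] at h1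
    exact h1.trans (h2.trans (h3.trans h4)))
  have X_apply : ∀ y v, X y v = (L (rk v)).val y e := fun _ _ => rfl
  have key : ∀ (w : H) (g : CptFun Y H) (y : Y) (u : H),
      inner ℂ w ((L g).val y u) = inner ℂ e ((R (star (rk w))).val y (g.val y u)) := by
    intro w g y u
    have h1 := congrArg (fun z : CptFun Y H => z.val y u) (hLR (star (rk w)) g)
    change (star (rk w)).val y ((L g).val y u) = (R (star (rk w))).val y (g.val y u) at h1
    rw [rk_star] at h1
    rw [← h1, inner_smul_right, hee, mul_one]
  have X_inner : ∀ y v w, inner ℂ w (X y v) = inner ℂ e ((R (star (rk w))).val y v) := by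
    intro y v w
    rw [X_apply, key, rk_apply, hee, one_smul]
  have X_star : ∀ y w, star (X y) w = star ((R (star (rk w))).val y) e := by
    intro y w
    refine ext_inner_right ℂ fun v => ?_
    rw [ContinuousLinearMap.star_eq_adjoint, ContinuousLinearMap.star_eq_adjoint,
      ContinuousLinearMap.adjoint_inner_left, ContinuousLinearMap.adjoint_inner_left, X_inner]
  refine ⟨⟨X, fun v => ?_, fun v => ?_⟩, fun f => ?_⟩
  · exact (L (rk v)).continuous_val.clm_apply continuous_const
  · simp only [X_star]
    exact (continuous_star.comp (R (star (rk v))).continuous_val).clm_apply continuous_const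
  · refine Subtype.ext (funext fun y => ContinuousLinearMap.ext fun u => ?_)
    refine ext_inner_left ℂ fun w => ?_
    change inner ℂ w ((L f).val y u) = inner ℂ w (X y (f.val y u))
    rw [X_inner, key]

end Corona

section Extension

/-- An extension `0 → I → B → A → 0` of C*-algebras with `B` and `A` unital. -/
structure CStarExtension (I B A : Type*) [NonUnitalCStarAlgebra I] [CStarAlgebra B]
    [CStarAlgebra A] where
  incl : I →⋆ₙₐ[ℂ] B
  proj : B →⋆ₐ[ℂ] A
  incl_injective : Function.Injective incl
  proj_surjective : Function.Surjective proj
  proj_eq_zero_iff : ∀ b, proj b = 0 ↔ ∃ f, incl f = b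

variable {Y : Type*} [TopologicalSpace Y] [CompactSpace Y]
variable {H : Type*} [NormedAddCommGroup H] [InnerProductSpace ℂ H] [CompleteSpace H]
variable {B A : Type*} [CStarAlgebra B] [CStarAlgebra A]

namespace CStarExtension

theorem exists_incl_mul {I : Type*} [NonUnitalCStarAlgebra I] (ξ : CStarExtension I B A)
    (b : B) (f : I) : ∃ g, ξ.incl g = b * ξ.incl f :=
  (ξ.proj_eq_zero_iff _).1 (by rw [map_mul, (ξ.proj_eq_zero_iff (ξ.incl f)).2 ⟨f, rfl⟩, mul_zero])

theorem exists_mul_incl {I : Type*} [NonUnitalCStarAlgebra I] (ξ : CStarExtension I B A)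
    (b : B) (f : I) : ∃ g, ξ.incl g = ξ.incl f * b :=
  (ξ.proj_eq_zero_iff _).1 (by rw [map_mul, (ξ.proj_eq_zero_iff (ξ.incl f)).2 ⟨f, rfl⟩, zero_mul])

variable (ξ : CStarExtension (CptFun Y H) B A)

theorem exists_multiplier (b : B) : ∃ x : Mult Y H,
    ∀ f g, ξ.incl g = b * ξ.incl f → toMult g = x * toMult f := by
  choose L hL using ξ.exists_incl_mul b
  choose R hR using ξ.exists_mul_incl b
  have hn : ∀ f, ‖ξ.incl f‖ = ‖f‖ := NonUnitalStarAlgHom.norm_map ξ.incl ξ.incl_injective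
  obtain ⟨x, hx⟩ := exists_mult L R
    (fun f g => ξ.incl_injective (by simp only [map_add, hL, mul_add]))
    (fun c f => ξ.incl_injective (by simp only [map_smul, hL, mul_smul_comm])) ‖b‖
    (fun f => by rw [← hn, ← hn, hL]; exact norm_mul_le _ _)
    (fun f g => ξ.incl_injective (by simp only [map_mul, hL, hR, mul_assoc]))
  refine ⟨x, fun f g hg => ?_⟩
  rw [← hL] at hg
  rw [ξ.incl_injective hg, hx]

/-- The function `x ∈ M(Y)` with `ξ.incl (x f) = b (ξ.incl f)` for all `f ∈ C(Y) ⊗ K(H)`. -/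
def multiplierFun (b : B) : Mult Y H := (ξ.exists_multiplier b).choose

theorem multiplierFun_spec {b : B} {f g : CptFun Y H} (h : ξ.incl g = b * ξ.incl f) :
    toMult g = ξ.multiplierFun b * toMult f :=
  (ξ.exists_multiplier b).choose_spec f g h

theorem eq_multiplierFun {b : B} {x : Mult Y H}
    (h : ∀ f g, ξ.incl g = b * ξ.incl f → toMult g = x * toMult f) : x = ξ.multiplierFun b := by
  refine mult_ext fun f => ?_
  obtain ⟨g, hg⟩ := ξ.exists_incl_mul b f
  rw [← h f g hg, ξ.multiplierFun_spec hg]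

theorem multiplierFun_spec_right {b : B} {f g : CptFun Y H} (h : ξ.incl g = ξ.incl f * b) :
    toMult g = toMult f * ξ.multiplierFun b := by
  refine mult_ext fun k => ?_
  obtain ⟨l, hl⟩ := ξ.exists_incl_mul b k
  rw [mul_assoc, ← ξ.multiplierFun_spec hl, ← map_mul, ← map_mul]
  congr 1
  apply ξ.incl_injective
  rw [map_mul, map_mul, h, hl, mul_assoc]

/-- The canonical *-homomorphism `B → M(C(Y) ⊗ K(H))` by which `B` acts on its ideal. -/
def multiplier : B →⋆ₐ[ℂ] Mult Y H where
  toFun := ξ.multiplierFun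
  map_one' := (ξ.eq_multiplierFun fun f g h => by
    rw [one_mul] at h ⊢; rw [ξ.incl_injective h]).symm
  map_mul' b c := (ξ.eq_multiplierFun fun f g h => by
    obtain ⟨k, hk⟩ := ξ.exists_incl_mul c f
    rw [mul_assoc, ← ξ.multiplierFun_spec hk]
    exact ξ.multiplierFun_spec (by rw [h, hk, mul_assoc])).symm
  map_zero' := (ξ.eq_multiplierFun fun f g h => by
    rw [zero_mul, ← map_zero ξ.incl] at h
    rw [ξ.incl_injective h, map_zero, zero_mul]).symm
  map_add' b c := (ξ.eq_multiplierFun fun f g h => by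
    obtain ⟨k, hk⟩ := ξ.exists_incl_mul b f
    obtain ⟨l, hl⟩ := ξ.exists_incl_mul c f
    rw [add_mul, ← hk, ← hl, ← map_add] at h
    rw [ξ.incl_injective h, add_mul, map_add, ξ.multiplierFun_spec hk, ξ.multiplierFun_spec hl]).symm
  commutes' r := (ξ.eq_multiplierFun fun f g h => by
    rw [Algebra.algebraMap_eq_smul_one, smul_one_mul, ← map_smul] at h
    rw [ξ.incl_injective h, Algebra.algebraMap_eq_smul_one, smul_one_mul, map_smul]).symm
  map_star' b := (ξ.eq_multiplierFun fun f g h => by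
    apply star_injective
    rw [star_mul, star_star, ← map_star, ← map_star]
    exact ξ.multiplierFun_spec_right (by rw [map_star, h, star_mul, star_star, map_star])).symm

/-- `b (incl f) = incl (x f)` for the element `x` of `M(Y)` by which `b` acts. -/
theorem multiplier_spec (b : B) {f g : CptFun Y H} :
    ξ.incl g = b * ξ.incl f ↔ toMult g = ξ.multiplier b * toMult f := by
  refine ⟨ξ.multiplierFun_spec, fun h => ?_⟩
  obtain ⟨k, hk⟩ := ξ.exists_incl_mul b f
  have h1 : toMult g = toMult k := h.trans (ξ.multiplierFun_spec hk).symm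
  rw [toMult_injective h1, hk]

theorem multiplier_incl (f : CptFun Y H) : ξ.multiplier (ξ.incl f) = toMult f :=
  (ξ.eq_multiplierFun fun k g h => by
    rw [← map_mul] at h
    rw [ξ.incl_injective h, map_mul]).symm

theorem toCorona_multiplier_congr {b c : B} (h : ξ.proj b = ξ.proj c) :
    toCorona (ξ.multiplier b) = toCorona (ξ.multiplier c) := by
  rw [← sub_eq_zero, ← map_sub] at h
  obtain ⟨f, hf⟩ := (ξ.proj_eq_zero_iff _).1 h
  rw [← sub_eq_zero, ← map_sub, ← map_sub, toCorona_eq_zero]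
  exact ⟨f, by rw [← ξ.multiplier_incl, hf]⟩

/-- The Busby invariant `A → Q(Y)` of an extension of `A` by `C(Y) ⊗ K(H)`: it sends the image of
`b ∈ B` in `A` to the class of the multiplier by which `b` acts on the ideal. -/
def busby : A →⋆ₐ[ℂ] Corona Y H where
  toFun a := toCorona (ξ.multiplier (Function.surjInv ξ.proj_surjective a))
  map_one' :=
    (ξ.toCorona_multiplier_congr (c := 1) (by simp only [Function.surjInv_eq, map_one])).trans
      (by rw [map_one, map_one])
  map_mul' a b :=
    (ξ.toCorona_multiplier_congr (c := Function.surjInv ξ.proj_surjective a *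
      Function.surjInv ξ.proj_surjective b) (by simp only [Function.surjInv_eq, map_mul])).trans
      (by rw [map_mul, map_mul])
  map_zero' :=
    (ξ.toCorona_multiplier_congr (c := 0) (by simp only [Function.surjInv_eq, map_zero])).trans
      (by rw [map_zero, map_zero])
  map_add' a b :=
    (ξ.toCorona_multiplier_congr (c := Function.surjInv ξ.proj_surjective a +
      Function.surjInv ξ.proj_surjective b) (by simp only [Function.surjInv_eq, map_add])).trans
      (by rw [map_add, map_add])
  commutes' r :=
    (ξ.toCorona_multiplier_congr (c := algebraMap ℂ B r)
      (by simp only [Function.surjInv_eq, AlgHomClass.commutes])).trans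
      (by rw [AlgHomClass.commutes, AlgHomClass.commutes])
  map_star' a :=
    (ξ.toCorona_multiplier_congr (c := star (Function.surjInv ξ.proj_surjective a))
      (by simp only [Function.surjInv_eq, map_star])).trans
      (by rw [map_star, map_star])

theorem busby_proj (b : B) : ξ.busby (ξ.proj b) = toCorona (ξ.multiplier b) :=
  ξ.toCorona_multiplier_congr (Function.surjInv_eq ξ.proj_surjective _)

/-- The extension is homogeneous: `ev_y ∘ τ : A → Q` is injective for every `y ∈ Y`, where `τ` is
the Busby invariant. -/
def IsHomogeneous : Prop := ∀ y : Y, Function.Injective fun a => evCorona y (ξ.busby a)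

end CStarExtension

end Extension

section Suspension

variable {A : Type*} [CStarAlgebra A]

section DirectSum

variable {ι : Type*} {G : ι → Type*} [∀ i, NormedAddCommGroup (G i)]
  [∀ i, InnerProductSpace ℂ (G i)] [∀ i, CompleteSpace (G i)]

/-- The direct sum of a family of representations of a C*-algebra on Hilbert spaces. -/
def directSumRep (ρ : ∀ i, A →⋆ₐ[ℂ] (G i →L[ℂ] G i)) : A →⋆ₐ[ℂ] (lp G 2 →L[ℂ] lp G 2) where
  toFun a := LinearMap.mkContinuous
    { toFun := fun x => ⟨fun i => ρ i a (x i), by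
        have hx := ((lp.memℓp x).norm.const_mul ‖a‖)
        refine hx.mono fun i => ?_
        exact (ρ i a).le_of_opNorm_le (NonUnitalStarAlgHom.norm_apply_le (ρ i) a) (x i)⟩
      map_add' := fun x y => lp.ext (funext fun i => map_add (ρ i a) (x i) (y i))
      map_smul' := fun c x => lp.ext (funext fun i => map_smul (ρ i a) c (x i)) } ‖a‖ (by
    intro x
    have h : ‖((‖a‖ : ℝ) : ℂ) • x‖ = ‖a‖ * ‖x‖ := by rw [norm_smul]; simp
    rw [← h]
    refine lp.norm_mono two_ne_zero fun i => ?_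
    have h2 := (ρ i a).le_of_opNorm_le (NonUnitalStarAlgHom.norm_apply_le (ρ i) a) (x i)
    change _ ≤ ‖((‖a‖ : ℝ) : ℂ) • x i‖
    rw [norm_smul]
    simpa using h2)
  map_one' := by
    ext x i
    change ρ i 1 (x i) = x i
    rw [map_one]; rfl
  map_mul' a b := by
    ext x i
    change ρ i (a * b) (x i) = ρ i a (ρ i b (x i))
    rw [map_mul]; rfl
  map_zero' := by
    ext x i
    change ρ i 0 (x i) = 0
    rw [map_zero]; rfl
  map_add' a b := by
    ext x i
    change ρ i (a + b) (x i) = ρ i a (x i) + ρ i b (x i)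
    rw [map_add]; rfl
  commutes' r := by
    ext x i
    change ρ i (algebraMap ℂ A r) (x i) = r • x i
    rw [AlgHomClass.commutes]; rfl
  map_star' a := by
    refine (ContinuousLinearMap.eq_adjoint_iff _ _).2 fun x y => ?_
    rw [lp.inner_eq_tsum, lp.inner_eq_tsum]
    refine tsum_congr fun i => ?_
    change inner ℂ (ρ i (star a) (x i)) (y i) = inner ℂ (x i) (ρ i a (y i))
    rw [map_star, ContinuousLinearMap.star_eq_adjoint, ContinuousLinearMap.adjoint_inner_left]

end DirectSum

variable (A)

/-- The Hilbert space of the universal representation of `A`: the direct sum of the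
Gelfand-Naimark-Segal spaces of all positive functionals. -/
def UnivSpace : Type _ :=
  letI := CStarAlgebra.spectralOrder A
  haveI := CStarAlgebra.spectralOrderedRing A
  lp (fun f : A →ₚ[ℂ] ℂ => f.GNS) 2

instance : NormedAddCommGroup (UnivSpace A) :=
  letI := CStarAlgebra.spectralOrder A
  haveI := CStarAlgebra.spectralOrderedRing A
  lp.normedAddCommGroup (E := fun f : A →ₚ[ℂ] ℂ => f.GNS) (p := 2)

instance : InnerProductSpace ℂ (UnivSpace A) :=
  letI := CStarAlgebra.spectralOrder A
  haveI := CStarAlgebra.spectralOrderedRing A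
  lp.instInnerProductSpace (𝕜 := ℂ) (G := fun f : A →ₚ[ℂ] ℂ => f.GNS)

instance : CompleteSpace (UnivSpace A) :=
  letI := CStarAlgebra.spectralOrder A
  haveI := CStarAlgebra.spectralOrderedRing A
  lp.completeSpace (E := fun f : A →ₚ[ℂ] ℂ => f.GNS) (p := 2)

/-- The universal representation of `A`, a faithful unital representation. -/
def univRep : A →⋆ₐ[ℂ] (UnivSpace A →L[ℂ] UnivSpace A) :=
  letI := CStarAlgebra.spectralOrder A
  haveI := CStarAlgebra.spectralOrderedRing A
  directSumRep fun f : A →ₚ[ℂ] ℂ => f.gnsStarAlgHom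

/-- `A ⊗ K = A ⊗ K(ℓ²(ℕ))`, as operators on `UnivSpace A ⊗ ℓ²(ℕ)`: the closed linear span of the
elements `a ⊗ p_{ij}`. -/
def stabilization : Submodule ℂ (Seq (UnivSpace A) →L[ℂ] Seq (UnivSpace A)) :=
  (Submodule.span ℂ {T | ∃ (a : A) (i j : ℕ), T = unitOp (univRep A a) i j}).topologicalClosure

/-- The `m`-torsioned quantum double suspension `Σ²_m A`: the C*-algebra of operators on
`UnivSpace A ⊗ ℓ²(ℕ)` generated by `A ⊗ K` and `1 ⊗ (S*)^m`. -/
def torsionedQDS (m : ℤ) : StarSubalgebra ℂ (Seq (UnivSpace A) →L[ℂ] Seq (UnivSpace A)) :=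
  (StarAlgebra.adjoin ℂ
    ((stabilization A : Set (Seq (UnivSpace A) →L[ℂ] Seq (UnivSpace A))) ∪
      {shiftPow (UnivSpace A) m})).topologicalClosure

instance (m : ℤ) : IsClosed
    (torsionedQDS A m : Set (Seq (UnivSpace A) →L[ℂ] Seq (UnivSpace A))) :=
  StarSubalgebra.isClosed_topologicalClosure _

/-- `Σ²_m A` as a C*-algebra. -/
def TorsionedQDS (m : ℤ) : Type _ := torsionedQDS A m

instance (m : ℤ) : CStarAlgebra (TorsionedQDS A m) :=
  StarSubalgebra.cstarAlgebra (torsionedQDS A m)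

/-- The defining inclusion of `Σ²_m A` into the operators on `UnivSpace A ⊗ ℓ²(ℕ)`. -/
def TorsionedQDS.toOp (m : ℤ) :
    TorsionedQDS A m →⋆ₐ[ℂ] (Seq (UnivSpace A) →L[ℂ] Seq (UnivSpace A)) :=
  (torsionedQDS A m).subtype

variable {A}

/-- The element `a ⊗ p_{ij}` of `Σ²_m A`. -/
def qdsUnit (m : ℤ) (a : A) (i j : ℕ) : TorsionedQDS A m :=
  ⟨unitOp (univRep A a) i j, StarSubalgebra.le_topologicalClosure _ (StarAlgebra.subset_adjoin ℂ _
    (Or.inl (Submodule.le_topologicalClosure _ (Submodule.subset_span ⟨a, i, j, rfl⟩))))⟩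

variable (A) in
/-- The element `1 ⊗ (S*)^m` of `Σ²_m A`. -/
def qdsShift (m : ℤ) : TorsionedQDS A m :=
  ⟨shiftPow (UnivSpace A) m, StarSubalgebra.le_topologicalClosure _ (StarAlgebra.subset_adjoin ℂ _
    (Or.inr rfl))⟩

variable {Y : Type*} [TopologicalSpace Y] [CompactSpace Y]
variable {H : Type*} [NormedAddCommGroup H] [InnerProductSpace ℂ H] [CompleteSpace H]

/-- The element `f ⊗ p_{ij}` of `C(Y) ⊗ K(H) ⊗ K(ℓ²(ℕ)) = C(Y, K(H ⊗ ℓ²(ℕ)))`. -/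
def CptFun.tensor (f : CptFun Y H) (i j : ℕ) : CptFun Y (Seq H) :=
  CptFun.mk (fun y => unitOp (f.val y) i j)
    (continuous_const.clm_comp (f.continuous_val.clm_comp continuous_const))
    fun y => isCompactOperator_unitOp (f.isCompactOperator_val y) i j

/-- The element `x ⊗ p_{ij} = (x_y ⊗ p_{ij})_{y ∈ Y}` of `M(C(Y) ⊗ K(H) ⊗ K(ℓ²(ℕ)))`. -/
def multTensor (x : Mult Y H) (i j : ℕ) : Mult Y (Seq H) :=
  ⟨fun y => unitOp ((x : Y → H →L[ℂ] H) y) i j,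
    fun v => (lp.singleContinuousLinearMap ℂ (fun _ : ℕ => H) 2 i).continuous.comp (x.2.1 (v j)),
    fun v => by
      simp only [star_unitOp]
      exact (lp.singleContinuousLinearMap ℂ (fun _ : ℕ => H) 2 j).continuous.comp (x.2.2 (v i))⟩

variable (Y H) in
/-- The constant function `1 ⊗ (S*)^m` in `M(C(Y) ⊗ K(H) ⊗ K(ℓ²(ℕ)))`. -/
def multShift (m : ℤ) : Mult Y (Seq H) :=
  ⟨fun _ => shiftPow H m, fun _ => continuous_const, fun _ => continuous_const⟩

theorem toCorona_multTensor_congr {x x' : Mult Y H} (i j : ℕ) (h : toCorona x = toCorona x') :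
    toCorona (multTensor x i j) = toCorona (multTensor x' i j) := by
  rw [← sub_eq_zero, ← map_sub, toCorona_eq_zero] at h ⊢
  obtain ⟨f, hf⟩ := h
  refine ⟨f.tensor i j, Subtype.ext (funext fun y => ?_)⟩
  have h1 : f.val y = (x : Y → H →L[ℂ] H) y - (x' : Y → H →L[ℂ] H) y :=
    congrArg (fun z : Mult Y H => (z : Y → H →L[ℂ] H) y) hf
  change unitOp (f.val y) i j
    = unitOp ((x : Y → H →L[ℂ] H) y) i j - unitOp ((x' : Y → H →L[ℂ] H) y) i j
  rw [h1]
  simp only [unitOp, ContinuousLinearMap.sub_comp, ContinuousLinearMap.comp_sub]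

/-- The map `Q(Y) → Q(C(Y) ⊗ K(H) ⊗ K(ℓ²(ℕ)))`, `[x] ↦ [x ⊗ p_{ij}]`. -/
def coronaTensor (q : Corona Y H) (i j : ℕ) : Corona Y (Seq H) :=
  toCorona (multTensor (Function.surjInv toCorona_surjective q) i j)

theorem coronaTensor_toCorona (x : Mult Y H) (i j : ℕ) :
    coronaTensor (toCorona x) i j = toCorona (multTensor x i j) :=
  toCorona_multTensor_congr i j (Function.surjInv_eq toCorona_surjective _)

variable {B : Type*} [CStarAlgebra B]

/-- `φ = Σ²_m α`: the *-homomorphism `Σ²_m B → Σ²_m A` given on the generators by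
`b ⊗ p_{ij} ↦ α(b) ⊗ p_{ij}` and `1 ⊗ (S*)^m ↦ 1 ⊗ (S*)^m`. A *-homomorphism of C*-algebras is
continuous, so there is at most one such `φ`. -/
def IsSuspensionHom (m : ℤ) (α : B →⋆ₐ[ℂ] A) (φ : TorsionedQDS B m →⋆ₐ[ℂ] TorsionedQDS A m) :
    Prop :=
  (∀ b i j, φ (qdsUnit m b i j) = qdsUnit m (α b) i j) ∧ φ (qdsShift B m) = qdsShift A m

/-- `θ = Σ²_m τ`: the *-homomorphism `Σ²_m A → Q(C(Y) ⊗ K(H) ⊗ K(ℓ²(ℕ)))` given on the generators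
by `a ⊗ p_{ij} ↦ [τ(a)_y ⊗ p_{ij}]_{y ∈ Y}` and `1 ⊗ (S*)^m ↦ [1 ⊗ 1 ⊗ (S*)^m]`. A *-homomorphism
of C*-algebras is continuous, so there is at most one such `θ`. -/
def IsSuspensionInvariant (m : ℤ) (τ : A →⋆ₐ[ℂ] Corona Y H)
    (θ : TorsionedQDS A m →⋆ₐ[ℂ] Corona Y (Seq H)) : Prop :=
  (∀ a i j, θ (qdsUnit m a i j) = coronaTensor (τ a) i j) ∧
    θ (qdsShift A m) = toCorona (multShift Y H m)

end Suspension
end QDS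

end

/-!
An operator `T` on `G ⊗ ℓ²(ℕ)` is studied through its matrix entries `entry i j T`, operators on
`G`, which determine it (`op_ext`).

**Functoriality.** Let `π` be a faithful and `σ` an arbitrary unital representation of a C*-algebra
`E`. The pairs `(T, T')` of operators whose entries are `π(e_{ij})` and `σ(e_{ij})` for one matrix
`(e_{ij})` over `E` form a closed subspace `entryPairs π σ`. The pairs that map this subspace into
itself by left multiplication, together with their adjoints, form a C*-algebra `PairAlgebra π σ`,
which contains the generators `(π(e) ⊗ p_{ij}, σ(e) ⊗ p_{ij})` and the shifts. The first component
is injective on it, because the entries of `T` determine those of `T'`; hence it is isometric with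
closed range. For the universal representation `π`, which is faithful by `univRep_injective`, the
second component therefore gives a representation `suspensionRep m σ` of `Σ²_m E`, entrywise
`π(e_{ij}) ↦ σ(e_{ij})`. The homomorphism `Σ²_m α` (`suspensionHom`) and the homomorphism `Ψ` from
`Σ²_m B` to the multipliers of `C(Y) ⊗ K(H) ⊗ K(ℓ²(ℕ))` (`suspensionMult`) are instances of this.
`Σ²_m α` is surjective because *-homomorphisms have closed range.

**Exactness.** The linear span of all `b ⊗ p_{ij}` and all `1 ⊗ (S*)^k`, `k ∈ ℤ`, is stable under
multiplication by the generators of `Σ²_m B`, so every element of `Σ²_m B` is a limit of elements of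
the form `1 ⊗ T_p` plus a finite corner, with a Laurent polynomial `p`. If the image in `Σ²_m A` of
such an element is small, so is `1 ⊗ T_p`, as compression by powers of the shift shows. Hence the
kernel of `Σ²_m α` lies in `B ⊗ K` (`toOp_mem_stabilization`), when `A ≠ 0`; if `A = 0`, then
`C(Y) ⊗ K(H)` is unital, which forces `B = 0`. Elements of the kernel have entries in `C(Y) ⊗ K(H)`,
so `Ψ` maps the kernel isometrically into `C(Y) ⊗ K(H) ⊗ K(ℓ²(ℕ))`, and onto it, because finite
matrices over `C(Y) ⊗ K(H)` are dense (`CptFun.tendsto_sum_entry_tensor`). The inverse of this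
isomorphism is the inclusion of the ideal.

**Busby invariant.** By construction `Ψ` is the action of `Σ²_m B` on the ideal, so the Busby
invariant sends `Σ²_m α (T)` to the class of `Ψ(T)` (`suspensionExtension_busby`). If `Ψ(T)` is
compact at one point `y` and the given extension is homogeneous, then the entries of `T` lie in the
kernel of `α`, whence `Σ²_m α (T) = 0`.
-/

noncomputable section

namespace QDS

/-! ### Faithfulness of the universal representation, and closed ranges -/

section Faithful

variable {A : Type*} [CStarAlgebra A]

open ComplexStarModule in
/-- Positive functionals separate the points of a C*-algebra: the closed cone of positive elements
does not contain `-a*a`, so a real functional that is nonnegative on the cone is positive at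
`a*a`; it extends to a positive complex functional. -/
theorem exists_positiveLinearMap_ne_zero [PartialOrder A] [StarOrderedRing A] {a : A}
    (ha : a ≠ 0) : ∃ f : A →ₚ[ℂ] ℂ, f (star a * a) ≠ 0 := by
  have hpos : 0 ≤ star a * a := star_mul_self_nonneg a
  have hneg : -(star a * a) ∉ {x : A | 0 ≤ x} := by
    intro h
    have h0 : star a * a = 0 := le_antisymm (neg_nonneg.1 h) hpos
    exact ha (CStarRing.star_mul_self_eq_zero_iff a |>.1 h0)
  have hconv : Convex ℝ {x : A | 0 ≤ x} := convex_Ici (𝕜 := ℝ) (0 : A)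
  have hclosed : IsClosed {x : A | 0 ≤ x} := CStarAlgebra.isClosed_nonneg
  obtain ⟨f, u, hfu, hu⟩ := geometric_hahn_banach_point_closed hconv hclosed hneg
  have hu0 : u < 0 := by simpa using hu 0 le_rfl
  have hf : ∀ x, 0 ≤ x → 0 ≤ f x := by
    intro x hx
    by_contra! hlt
    have h1 := hu ((u / f x) • x) (smul_nonneg (div_nonneg_of_nonpos hu0.le hlt.le) hx)
    rw [map_smul, smul_eq_mul, div_mul_cancel₀ _ hlt.ne] at h1
    exact lt_irrefl _ h1
  -- The real part is taken first so that the complex extension agrees with `f` on selfadjoint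
  -- elements.
  let F : Module.Dual ℝ A := f.toLinearMap ∘ₗ (selfAdjoint.submodule ℝ A).subtype ∘ₗ realPart
  have hF : ∀ x, IsSelfAdjoint x → (F.extendRCLike : Module.Dual ℂ A) x = f x := by
    intro x hx
    rw [Module.Dual.extendRCLike_apply]
    have h1 : F x = f x := congrArg f hx.coe_realPart
    have h2 : F ((RCLike.I : ℂ) • x) = 0 := by
      change f (ℜ (Complex.I • x) : A) = 0
      rw [realPart_I_smul, hx.imaginaryPart]
      simp
    rw [h1, h2]
    simp
  refine ⟨PositiveLinearMap.mk₀ (F.extendRCLike : Module.Dual ℂ A) fun x hx => ?_, ?_⟩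
  · rw [hF x (.of_nonneg hx)]
    exact Complex.zero_le_real.2 (hf x hx)
  · change (F.extendRCLike : Module.Dual ℂ A) (star a * a) ≠ 0
    rw [hF _ (.star_mul_self a)]
    rw [map_neg] at hfu
    exact Complex.ofReal_ne_zero.2 (by linarith)

/-- The universal representation is faithful: if `f (a*a) ≠ 0`, then `a` moves the cyclic vector of
the GNS representation of `f`. -/
theorem univRep_injective : Function.Injective (univRep A) := by
  classical
  let := CStarAlgebra.spectralOrder A
  have := CStarAlgebra.spectralOrderedRing A
  rw [injective_iff_map_eq_zero]
  intro a ha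
  by_contra hne
  obtain ⟨f, hf⟩ := exists_positiveLinearMap_ne_zero hne
  let e : f.GNS := ((f.toPreGNS 1 : f.PreGNS) : UniformSpace.Completion f.PreGNS)
  have h1 : univRep A a (lp.single 2 f e) = 0 := by rw [ha]; rfl
  have h2 : f.gnsStarAlgHom a (lp.single (E := fun f : A →ₚ[ℂ] ℂ => f.GNS) 2 f e f) = 0 :=
    congrArg (fun z : lp (fun f : A →ₚ[ℂ] ℂ => f.GNS) 2 => z f) h1
  rw [lp.single_apply_self] at h2
  have h3 : ((f.leftMulMapPreGNS a (f.toPreGNS 1) : f.PreGNS) :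
      UniformSpace.Completion f.PreGNS) = 0 :=
    (f.gnsNonUnitalStarAlgHom_apply_coe (a := a) (b := f.toPreGNS 1)).symm.trans h2
  have h4 : ‖f.leftMulMapPreGNS a (f.toPreGNS 1)‖ = 0 := by
    rw [← UniformSpace.Completion.norm_coe, h3, norm_zero]
  have h5 := f.preGNS_norm_sq (f.leftMulMapPreGNS a (f.toPreGNS 1))
  rw [h4] at h5
  apply hf
  simpa using h5.symm

end Faithful

section ClosedRange

variable {C D : Type*} [CStarAlgebra C] [CStarAlgebra D]

theorem continuous_starAlgHom (φ : C →⋆ₐ[ℂ] D) :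
    Continuous φ :=
  AddMonoidHomClass.continuous_of_bound φ 1 fun z => by
    simpa using NonUnitalStarAlgHom.norm_apply_le φ z

/-- A selfadjoint element in the range of a *-homomorphism lifts without increasing the norm: cut
off a selfadjoint lift by functional calculus. -/
theorem exists_isSelfAdjoint_preimage_norm_le (φ : C →⋆ₐ[ℂ] D) {y : D} (hy : IsSelfAdjoint y)
    (hr : y ∈ Set.range φ) : ∃ x, φ x = y ∧ ‖x‖ ≤ ‖y‖ := by
  rcases subsingleton_or_nontrivial D with hD | hD
  · exact ⟨0, Subsingleton.elim _ _, by simp⟩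
  obtain ⟨x₀, hx₀⟩ := hr
  obtain ⟨x, hx, hxy⟩ : ∃ x, IsSelfAdjoint x ∧ φ x = y := by
    refine ⟨realPart x₀, (realPart x₀).2, ?_⟩
    rw [map_realPart, hx₀, hy.coe_realPart]
  -- The cut-off function is the identity on `[-‖y‖, ‖y‖]`, which contains the spectrum of `y`.
  let g : ℝ → ℝ := fun t => max (-‖y‖) (min t ‖y‖)
  have hg : Continuous g := by fun_prop
  refine ⟨cfc g x, ?_, ?_⟩
  · have hφ : Continuous φ := continuous_starAlgHom φ
    rw [StarAlgHomClass.map_cfc φ g x, hxy]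
    refine (cfc_congr fun t ht => ?_).trans (cfc_id' ℝ y)
    have h1 : |t| ≤ ‖y‖ := by
      have := spectrum.norm_le_norm_of_mem ht
      simpa using this
    obtain ⟨h2, h3⟩ := abs_le.1 h1
    simp only [g, min_eq_left h3, max_eq_right h2]
  · refine norm_cfc_le (norm_nonneg _) fun t _ => ?_
    rw [Real.norm_eq_abs, abs_le]
    exact ⟨le_max_left _ _, max_le (by linarith [norm_nonneg y]) (min_le_right _ _)⟩

/-- The range of a *-homomorphism of C*-algebras is closed: elements of the range have lifts of at
most twice their norm. -/
theorem isClosed_range_starAlgHom (φ : C →⋆ₐ[ℂ] D) : IsClosed (Set.range φ) := by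
  have hlift : ∀ y ∈ Set.range φ, ∃ x, φ x = y ∧ ‖x‖ ≤ 2 * ‖y‖ := by
    rintro y ⟨x, rfl⟩
    obtain ⟨r, hr, hrn⟩ := exists_isSelfAdjoint_preimage_norm_le φ (realPart (φ x)).2
      ⟨realPart x, map_realPart φ x⟩
    obtain ⟨s, hs, hsn⟩ := exists_isSelfAdjoint_preimage_norm_le φ (imaginaryPart (φ x)).2
      ⟨imaginaryPart x, map_imaginaryPart φ x⟩
    refine ⟨r + Complex.I • s, ?_, ?_⟩
    · rw [map_add, map_smul, hr, hs, realPart_add_I_smul_imaginaryPart]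
    · have h1 := realPart.norm_le (φ x)
      have h2 := imaginaryPart.norm_le (φ x)
      have h3 := norm_add_le r (Complex.I • s)
      rw [norm_smul, Complex.norm_I, one_mul] at h3
      change ‖((realPart (φ x) : selfAdjoint D) : D)‖ ≤ _ at h1
      change ‖((imaginaryPart (φ x) : selfAdjoint D) : D)‖ ≤ _ at h2
      linarith
  let f : NormedAddGroupHom C D := ((φ : C →ₗ[ℂ] D).toAddMonoidHom).mkNormedAddGroupHom 1
    fun x => by simpa using NonUnitalStarAlgHom.norm_apply_le φ x
  have hsurj : f.SurjectiveOnWith f.range 2 := fun y hy => hlift y hy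
  have h := controlled_closure_of_complete (f := f) (K := f.range) two_pos one_pos hsurj
  refine isClosed_of_closure_subset fun y hy => ?_
  have hy' : y ∈ f.range.topologicalClosure := hy
  obtain ⟨x, hx, -⟩ := h y hy'
  exact ⟨x, hx⟩

end ClosedRange

/-! ### Matrix entries of operators -/

section Entries

variable {G : Type*} [NormedAddCommGroup G] [InnerProductSpace ℂ G]

/-- The `(i, j)` matrix entry of an operator on `G ⊗ ℓ²(ℕ)`. -/
def entry (i j : ℕ) : (Seq G →L[ℂ] Seq G) →L[ℂ] (G →L[ℂ] G) :=
  LinearMap.mkContinuous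
    { toFun := fun T => lp.evalCLM ℂ (fun _ : ℕ => G) 2 i ∘L T ∘L
        lp.singleContinuousLinearMap ℂ (fun _ : ℕ => G) 2 j
      map_add' := fun _ _ => by ext; rfl
      map_smul' := fun _ _ => by ext; rfl } 1 fun T => by
    refine ContinuousLinearMap.opNorm_le_bound _ (by positivity) fun v => ?_
    calc ‖T (lp.single 2 j v) i‖ ≤ ‖T (lp.single 2 j v)‖ := lp.norm_apply_le_norm two_ne_zero _ i
      _ ≤ ‖T‖ * ‖lp.single (E := fun _ : ℕ => G) 2 j v‖ := T.le_opNorm _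
      _ = 1 * ‖T‖ * ‖v‖ := by rw [lp.norm_single (by norm_num), one_mul]

theorem entry_apply (i j : ℕ) (T : Seq G →L[ℂ] Seq G) (v : G) :
    entry i j T v = T (lp.single 2 j v) i := rfl

theorem entry_unitOp (X : G →L[ℂ] G) (i j k l : ℕ) :
    entry k l (unitOp X i j) = if k = i ∧ l = j then X else 0 := by
  ext v
  rw [entry_apply, unitOp_apply, lp.single_apply, lp.single_apply]
  by_cases hk : k = i
  · subst hk
    by_cases hl : l = j
    · subst hl; simp
    · simp [hl, Ne.symm hl]
  · simp [hk]

theorem entry_unitOp_mul (X : G →L[ℂ] G) (i j k l : ℕ) (T : Seq G →L[ℂ] Seq G) :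
    entry k l (unitOp X i j * T) = if k = i then X * entry j l T else 0 := by
  ext v
  rw [entry_apply, mul_apply_eq_comp, unitOp_apply, lp.single_apply]
  by_cases hk : k = i
  · subst hk; simp; rfl
  · simp [hk]

theorem entry_leftShift_mul (k l : ℕ) (T : Seq G →L[ℂ] Seq G) :
    entry k l (leftShift G * T) = entry (k + 1) l T := rfl

theorem leftShift_single_zero (v : G) : leftShift G (lp.single 2 0 v) = 0 := by
  ext n
  rw [leftShift_apply, lp.single_apply]
  simp

theorem leftShift_single_succ (j : ℕ) (v : G) :
    leftShift G (lp.single 2 (j + 1) v) = lp.single 2 j v := by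
  ext n
  rw [leftShift_apply, lp.single_apply, lp.single_apply]
  simp [Pi.single_apply]

theorem entry_mul_leftShift_zero (k : ℕ) (T : Seq G →L[ℂ] Seq G) :
    entry k 0 (T * leftShift G) = 0 := by
  ext v
  rw [entry_apply, mul_apply_eq_comp, leftShift_single_zero]
  simp

theorem entry_mul_leftShift_succ (k l : ℕ) (T : Seq G →L[ℂ] Seq G) :
    entry k (l + 1) (T * leftShift G) = entry k l T := by
  ext v
  rw [entry_apply, mul_apply_eq_comp, leftShift_single_succ]
  rfl

theorem hasSum_apply_single (T : Seq G →L[ℂ] Seq G) (x : Seq G) :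
    HasSum (fun j => T (lp.single 2 j (x j))) (T x) :=
  T.hasSum (lp.hasSum_single (p := 2) (by norm_num) x)

/-- An operator on `G ⊗ ℓ²(ℕ)` is determined by its matrix entries. -/
theorem op_ext {T S : Seq G →L[ℂ] Seq G} (h : ∀ i j, entry i j T = entry i j S) : T = S := by
  ext1 x
  refine (hasSum_apply_single T x).unique ?_
  convert hasSum_apply_single S x using 2 with j
  exact lp.ext (funext fun i => DFunLike.congr_fun (h i j) (x j))

variable [CompleteSpace G]

theorem entry_star (i j : ℕ) (T : Seq G →L[ℂ] Seq G) :
    entry i j (star T) = star (entry j i T) := by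
  refine (ContinuousLinearMap.eq_adjoint_iff _ _).2 fun x y => ?_
  have h1 : inner ℂ (star T (lp.single 2 j x)) (lp.single (E := fun _ : ℕ => G) 2 i y)
      = inner ℂ (lp.single (E := fun _ : ℕ => G) 2 j x) (T (lp.single 2 i y)) := by
    rw [ContinuousLinearMap.star_eq_adjoint, ContinuousLinearMap.adjoint_inner_left]
  rwa [lp.inner_single_left, lp.inner_single_right] at h1

theorem entry_star_leftShift_mul_zero (l : ℕ) (T : Seq G →L[ℂ] Seq G) :
    entry 0 l (star (leftShift G) * T) = 0 := by
  rw [← star_star (star (leftShift G) * T), entry_star, star_mul, star_star,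
    entry_mul_leftShift_zero, star_zero]

theorem entry_star_leftShift_mul_succ (k l : ℕ) (T : Seq G →L[ℂ] Seq G) :
    entry (k + 1) l (star (leftShift G) * T) = entry k l T := by
  rw [← star_star (star (leftShift G) * T), entry_star, star_mul, star_star,
    entry_mul_leftShift_succ, entry_star, star_star]

theorem entry_mul_star_leftShift (k l : ℕ) (T : Seq G →L[ℂ] Seq G) :
    entry k l (T * star (leftShift G)) = entry k (l + 1) T := by
  rw [← star_star (T * star (leftShift G)), entry_star, star_mul, star_star,
    entry_leftShift_mul, entry_star, star_star]

theorem unitOp_mul_leftShift (X : G →L[ℂ] G) (i j : ℕ) :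
    unitOp X i j * leftShift G = unitOp X i (j + 1) := rfl

theorem leftShift_mul_unitOp_zero (X : G →L[ℂ] G) (j : ℕ) :
    leftShift G * unitOp X 0 j = 0 := by
  ext1 x; exact leftShift_single_zero _

theorem leftShift_mul_unitOp_succ (X : G →L[ℂ] G) (i j : ℕ) :
    leftShift G * unitOp X (i + 1) j = unitOp X i j := by
  ext1 x; exact leftShift_single_succ _ _

theorem star_leftShift_mul_unitOp (X : G →L[ℂ] G) (i j : ℕ) :
    star (leftShift G) * unitOp X i j = unitOp X (i + 1) j := by
  rw [← star_star (star (leftShift G) * unitOp X i j), star_mul, star_star, star_unitOp,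
    unitOp_mul_leftShift, star_unitOp, star_star]

theorem unitOp_mul_unitOp (X Z : G →L[ℂ] G) (i j k l : ℕ) :
    unitOp X i j * unitOp Z k l = if j = k then unitOp (X * Z) i l else 0 := by
  ext1 x
  rw [mul_apply_eq_comp, unitOp_apply, unitOp_apply, lp.single_apply]
  by_cases h : j = k
  · subst h; simp [unitOp_apply]
  · simp [h]

end Entries

/-! ### Pairs of operators with corresponding entries -/

section Stabilizer

variable {C : Type*} [Ring C] [StarRing C] [Algebra ℂ C] [StarModule ℂ C]

/-- The *-subalgebra of all `X` such that left multiplication by `X` and by `X*` maps the subspace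
`D` into itself. -/
def stabilizer (D : Submodule ℂ C) : StarSubalgebra ℂ C where
  carrier := {X | ∀ Z ∈ D, X * Z ∈ D ∧ star X * Z ∈ D}
  mul_mem' {X W} hX hW Z hZ := by
    refine ⟨?_, ?_⟩
    · rw [mul_assoc]; exact (hX _ (hW Z hZ).1).1
    · rw [star_mul, mul_assoc]; exact (hW _ (hX Z hZ).2).2
  add_mem' {X W} hX hW Z hZ := by
    refine ⟨?_, ?_⟩
    · rw [add_mul]; exact D.add_mem (hX Z hZ).1 (hW Z hZ).1
    · rw [star_add, add_mul]; exact D.add_mem (hX Z hZ).2 (hW Z hZ).2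
  algebraMap_mem' r Z hZ := by
    refine ⟨?_, ?_⟩
    · rw [← Algebra.smul_def]; exact D.smul_mem _ hZ
    · rw [← algebraMap_star_comm, ← Algebra.smul_def]; exact D.smul_mem _ hZ
  star_mem' {X} hX Z hZ := ⟨(hX Z hZ).2, by rw [star_star]; exact (hX Z hZ).1⟩

theorem mem_stabilizer {D : Submodule ℂ C} {X : C} :
    X ∈ stabilizer D ↔ ∀ Z ∈ D, X * Z ∈ D ∧ star X * Z ∈ D := Iff.rfl

theorem mem_of_mem_stabilizer {D : Submodule ℂ C} (h1 : 1 ∈ D) {X : C} (hX : X ∈ stabilizer D) :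
    X ∈ D := by
  simpa using (hX 1 h1).1

theorem isClosed_stabilizer [TopologicalSpace C] [ContinuousMul C] [ContinuousStar C]
    {D : Submodule ℂ C} (hD : IsClosed (D : Set C)) : IsClosed (stabilizer D : Set C) := by
  have h : (stabilizer D : Set C) =
      ⋂ Z ∈ D, {X | X * Z ∈ (D : Set C)} ∩ {X | star X * Z ∈ (D : Set C)} := by
    ext X; simp [mem_stabilizer]
  rw [h]
  refine isClosed_biInter fun Z _ => IsClosed.inter ?_ ?_
  · exact hD.preimage (continuous_id.mul continuous_const)
  · exact hD.preimage (continuous_star.mul continuous_const)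

end Stabilizer

section ShiftPow

variable {G : Type*} [NormedAddCommGroup G] [InnerProductSpace ℂ G] [CompleteSpace G]

theorem entry_one (i j : ℕ) : entry i j (1 : Seq G →L[ℂ] Seq G) = if i = j then 1 else 0 := by
  ext v
  rw [entry_apply, one_apply_eq_self, lp.single_apply]
  by_cases h : i = j
  · subst h; simp
  · simp [h]

theorem entry_leftShift_pow (n i j : ℕ) :
    entry i j (leftShift G ^ n) = if i + n = j then 1 else 0 := by
  induction n generalizing i with
  | zero => rw [pow_zero, entry_one, add_zero]
  | succ n ih => rw [pow_succ', entry_leftShift_mul, ih, add_right_comm, add_assoc]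

theorem entry_shiftPow (m : ℤ) (i j : ℕ) :
    entry i j (shiftPow G m) = if (i : ℤ) - j = m then 1 else 0 := by
  unfold shiftPow
  split_ifs with h1 h2 h2
  · rw [← star_pow, entry_star, entry_leftShift_pow, if_pos (by lia), star_one]
  · rw [← star_pow, entry_star, entry_leftShift_pow, if_neg (by lia), star_zero]
  · rw [entry_leftShift_pow, if_pos (by lia)]
  · rw [entry_leftShift_pow, if_neg (by lia)]

end ShiftPow

section Factor

variable {X C D : Type*}

/-- A *-homomorphism `g` with values in the range of an injective *-homomorphism `f` factors
through `f`. -/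
def factorThrough [NonUnitalNonAssocSemiring X] [Module ℂ X] [Star X] [NonUnitalNonAssocSemiring C]
    [Module ℂ C] [Star C] [NonUnitalNonAssocSemiring D] [Module ℂ D] [Star D] (f : C →⋆ₙₐ[ℂ] D)
    (hf : Function.Injective f) (g : X →⋆ₙₐ[ℂ] D) (h : ∀ x, ∃ c, f c = g x) : X →⋆ₙₐ[ℂ] C where
  toFun x := (h x).choose
  map_smul' r x := hf (by
    rw [(h _).choose_spec, MonoidHom.id_apply, map_smul, map_smul, (h x).choose_spec])
  map_zero' := hf (by rw [(h 0).choose_spec, map_zero, map_zero])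
  map_add' x y := hf (by
    rw [(h _).choose_spec, map_add, map_add, (h x).choose_spec, (h y).choose_spec])
  map_mul' x y := hf (by
    rw [(h _).choose_spec, map_mul, map_mul, (h x).choose_spec, (h y).choose_spec])
  map_star' x := hf (by rw [(h _).choose_spec, map_star, map_star, (h x).choose_spec])

theorem apply_factorThrough [NonUnitalNonAssocSemiring X] [Module ℂ X] [Star X]
    [NonUnitalNonAssocSemiring C] [Module ℂ C] [Star C] [NonUnitalNonAssocSemiring D] [Module ℂ D]
    [Star D] (f : C →⋆ₙₐ[ℂ] D) (hf : Function.Injective f) (g : X →⋆ₙₐ[ℂ] D)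
    (h : ∀ x, ∃ c, f c = g x) (x : X) : f (factorThrough f hf g h x) = g x :=
  (h x).choose_spec

variable [CStarAlgebra X] [CStarAlgebra C] [CStarAlgebra D]

/-- The unital form of `factorThrough`. -/
def factorThroughUnital (f : C →⋆ₐ[ℂ] D) (hf : Function.Injective f) (g : X →⋆ₐ[ℂ] D)
    (h : ∀ x, g x ∈ Set.range f) : X →⋆ₐ[ℂ] C where
  __ := factorThrough (f : C →⋆ₙₐ[ℂ] D) hf (g : X →⋆ₙₐ[ℂ] D) h
  map_one' := hf ((h 1).choose_spec.trans (by rw [map_one, map_one]))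
  commutes' r := hf ((h _).choose_spec.trans (by rw [AlgHomClass.commutes, AlgHomClass.commutes]))

theorem apply_factorThroughUnital (f : C →⋆ₐ[ℂ] D) (hf : Function.Injective f) (g : X →⋆ₐ[ℂ] D)
    (h : ∀ x, g x ∈ Set.range f) (x : X) : f (factorThroughUnital f hf g h x) = g x :=
  (h x).choose_spec

end Factor

section Pair

variable {E : Type*} [CStarAlgebra E]
variable {G : Type*} [NormedAddCommGroup G] [InnerProductSpace ℂ G] [CompleteSpace G]
variable {G' : Type*} [NormedAddCommGroup G'] [InnerProductSpace ℂ G'] [CompleteSpace G']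
variable (π : E →⋆ₐ[ℂ] (G →L[ℂ] G)) (σ : E →⋆ₐ[ℂ] (G' →L[ℂ] G'))

/-- The pairs of operators whose entries are the images under `π` and `σ` of one matrix over
`E`. -/
def entryPairs : Submodule ℂ ((Seq G →L[ℂ] Seq G) × (Seq G' →L[ℂ] Seq G')) where
  carrier := {X | ∀ i j, ∃ e, π e = entry i j X.1 ∧ σ e = entry i j X.2}
  add_mem' := by
    intro X Z hX hZ i j
    obtain ⟨e, he, he'⟩ := hX i j
    obtain ⟨f, hf, hf'⟩ := hZ i j
    exact ⟨e + f, by simp [he, hf], by simp [he', hf']⟩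
  zero_mem' := fun i j => ⟨0, by simp, by simp⟩
  smul_mem' := by
    intro c X hX i j
    obtain ⟨e, he, he'⟩ := hX i j
    exact ⟨c • e, by simp [he], by simp [he']⟩

theorem mem_entryPairs {X : (Seq G →L[ℂ] Seq G) × (Seq G' →L[ℂ] Seq G')} :
    X ∈ entryPairs π σ ↔ ∀ i j, ∃ e, π e = entry i j X.1 ∧ σ e = entry i j X.2 := Iff.rfl

theorem isClosed_entryPairs :
    IsClosed (entryPairs π σ : Set ((Seq G →L[ℂ] Seq G) × (Seq G' →L[ℂ] Seq G'))) := by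
  have h : (entryPairs π σ : Set ((Seq G →L[ℂ] Seq G) × (Seq G' →L[ℂ] Seq G'))) =
      ⋂ (i : ℕ) (j : ℕ), (fun X => (entry i j X.1, entry i j X.2)) ⁻¹'
        Set.range (π.prod σ) := by
    ext X; simp [mem_entryPairs, Prod.ext_iff]
  rw [h]
  refine isClosed_iInter fun i => isClosed_iInter fun j => ?_
  exact (isClosed_range_starAlgHom (π.prod σ)).preimage
    (((entry i j).continuous.comp continuous_fst).prodMk
      ((entry i j).continuous.comp continuous_snd))

theorem one_mem_entryPairs : 1 ∈ entryPairs π σ := by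
  intro i j
  by_cases h : i = j
  · exact ⟨1, by simp [entry_one, h], by simp [entry_one, h]⟩
  · exact ⟨0, by simp [entry_one, h], by simp [entry_one, h]⟩

theorem unitOp_mem_stabilizer_entryPairs (e : E) (i j : ℕ) :
    (unitOp (π e) i j, unitOp (σ e) i j) ∈ stabilizer (entryPairs π σ) := by
  have key : ∀ (e : E) (i j : ℕ), ∀ Z ∈ entryPairs π σ,
      (unitOp (π e) i j, unitOp (σ e) i j) * Z ∈ entryPairs π σ := by
    intro e i j Z hZ k l
    obtain ⟨f, hf, hf'⟩ := hZ j l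
    refine ⟨if k = i then e * f else 0, ?_, ?_⟩
    · rw [Prod.fst_mul, entry_unitOp_mul, ← hf]; split_ifs <;> simp
    · rw [Prod.snd_mul, entry_unitOp_mul, ← hf']; split_ifs <;> simp
  refine fun Z hZ => ⟨key e i j Z hZ, ?_⟩
  rw [Prod.star_def]
  simp only [star_unitOp, ← map_star]
  exact key _ _ _ Z hZ

theorem leftShift_mem_stabilizer_entryPairs :
    (leftShift G, leftShift G') ∈ stabilizer (entryPairs π σ) := by
  refine fun Z hZ => ⟨fun i j => hZ (i + 1) j, fun i j => ?_⟩
  rw [Prod.star_def, Prod.fst_mul, Prod.snd_mul]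
  cases i with
  | zero => exact ⟨0, by simp [entry_star_leftShift_mul_zero]⟩
  | succ i =>
    simp only [entry_star_leftShift_mul_succ]
    exact hZ i j

theorem shiftPow_mem_stabilizer_entryPairs (m : ℤ) :
    (shiftPow G m, shiftPow G' m) ∈ stabilizer (entryPairs π σ) := by
  have h := leftShift_mem_stabilizer_entryPairs π σ
  unfold shiftPow
  split_ifs
  · exact pow_mem (star_mem h) m.toNat
  · exact pow_mem h (-m).toNat

instance : IsClosed (stabilizer (entryPairs π σ) :
    Set ((Seq G →L[ℂ] Seq G) × (Seq G' →L[ℂ] Seq G'))) :=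
  isClosed_stabilizer (isClosed_entryPairs π σ)

/-- The *-algebra of pairs of operators that stabilizes `entryPairs π σ`, as a C*-algebra. -/
def PairAlgebra : Type _ := stabilizer (entryPairs π σ)

instance : CStarAlgebra (PairAlgebra π σ) :=
  StarSubalgebra.cstarAlgebra (stabilizer (entryPairs π σ))

/-- The inclusion of the algebra of pairs. -/
def pairIncl : PairAlgebra π σ →⋆ₐ[ℂ] (Seq G →L[ℂ] Seq G) × (Seq G' →L[ℂ] Seq G') :=
  (stabilizer (entryPairs π σ)).subtype

/-- The first component, as a *-homomorphism. -/
def pairFst : PairAlgebra π σ →⋆ₐ[ℂ] (Seq G →L[ℂ] Seq G) :=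
  (StarAlgHom.fst ℂ _ _).comp (pairIncl π σ)

/-- The second component, as a *-homomorphism. -/
def pairSnd : PairAlgebra π σ →⋆ₐ[ℂ] (Seq G' →L[ℂ] Seq G') :=
  (StarAlgHom.snd ℂ _ _).comp (pairIncl π σ)

theorem exists_entry_pair (X : PairAlgebra π σ) (i j : ℕ) :
    ∃ e, π e = entry i j (pairFst π σ X) ∧ σ e = entry i j (pairSnd π σ X) :=
  mem_of_mem_stabilizer (one_mem_entryPairs π σ) X.2 i j

variable {π}

/-- The first component of a pair determines the second, because `π` is injective. -/
theorem pairFst_injective (hπ : Function.Injective π) : Function.Injective (pairFst π σ) := by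
  rw [injective_iff_map_eq_zero]
  intro X hX
  refine Subtype.ext (Prod.ext hX (op_ext fun i j => ?_))
  obtain ⟨e, he, he'⟩ := exists_entry_pair π σ X i j
  rw [hX, map_zero, map_eq_zero_iff π hπ] at he
  rw [he, map_zero] at he'
  change entry i j (pairSnd π σ X) = entry i j 0
  rw [← he', map_zero]

/-- Replacing a faithful representation by another one, entry by entry, does not increase the norm:
an injective *-homomorphism of C*-algebras is isometric. -/
theorem norm_snd_le_of_mem_stabilizer (hπ : Function.Injective π)
    {X : (Seq G →L[ℂ] Seq G) × (Seq G' →L[ℂ] Seq G')} (hX : X ∈ stabilizer (entryPairs π σ)) :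
    ‖X.2‖ ≤ ‖X.1‖ := by
  have h := NonUnitalStarAlgHom.norm_map (pairFst π σ) (pairFst_injective σ hπ) ⟨X, hX⟩
  exact (norm_snd_le X).trans h.ge

end Pair

/-! ### Functoriality of the quantum double suspension -/

section SuspensionRep

variable {A : Type*} [CStarAlgebra A] {m : ℤ}

theorem toOp_injective : Function.Injective (TorsionedQDS.toOp A m) := Subtype.val_injective

theorem norm_toOp (T : TorsionedQDS A m) : ‖TorsionedQDS.toOp A m T‖ = ‖T‖ := rfl

theorem toOp_qdsUnit (a : A) (i j : ℕ) :
    TorsionedQDS.toOp A m (qdsUnit m a i j) = unitOp (univRep A a) i j := rfl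

theorem toOp_qdsShift : TorsionedQDS.toOp A m (qdsShift A m) = shiftPow (UnivSpace A) m := rfl

theorem isometry_toOp : Isometry (TorsionedQDS.toOp A m) := isometry_subtype_coe

/-- A closed *-subalgebra of `Σ²_m A` that contains the generators `a ⊗ p_{ij}` and `1 ⊗ (S*)^m` is
everything. -/
theorem mem_of_generators_mem {S : StarSubalgebra ℂ (TorsionedQDS A m)}
    (hS : IsClosed (S : Set (TorsionedQDS A m))) (hu : ∀ a i j, qdsUnit m a i j ∈ S)
    (hs : qdsShift A m ∈ S) (T : TorsionedQDS A m) : T ∈ S := by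
  have hcl : IsClosed (S.map (TorsionedQDS.toOp A m) :
      Set (Seq (UnivSpace A) →L[ℂ] Seq (UnivSpace A))) :=
    (isometry_toOp (A := A) (m := m)).isClosedEmbedding.isClosedMap _ hS
  have hle : torsionedQDS A m ≤ S.map (TorsionedQDS.toOp A m) := by
    refine StarSubalgebra.topologicalClosure_minimal (StarAlgebra.adjoin_le ?_) hcl
    refine Set.union_subset ?_ ?_
    · refine Submodule.topologicalClosure_minimal
        (t := Subalgebra.toSubmodule (S.map (TorsionedQDS.toOp A m)).toSubalgebra) _
        (Submodule.span_le.2 ?_) hcl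
      rintro _ ⟨a, i, j, rfl⟩
      exact ⟨_, hu a i j, rfl⟩
    · rintro _ rfl
      exact ⟨_, hs, rfl⟩
  obtain ⟨T', hT', h⟩ := hle T.2
  rwa [toOp_injective (a₂ := T) h] at hT'

/-- The closure of a *-subalgebra, stated for an abstract C*-algebra in order to apply it to
`Σ²_m A` with the structure of its `CStarAlgebra` instance. -/
theorem exists_coe_eq_closure {D : Type*} [CStarAlgebra D] (S : StarSubalgebra ℂ D) :
    ∃ S' : StarSubalgebra ℂ D, (S' : Set D) = closure (S : Set D) :=
  ⟨S.topologicalClosure, rfl⟩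

/-- A *-subalgebra of `Σ²_m A` that contains the generators is dense. -/
theorem mem_closure_of_generators_mem {S : StarSubalgebra ℂ (TorsionedQDS A m)}
    (hu : ∀ a i j, qdsUnit m a i j ∈ S) (hs : qdsShift A m ∈ S) (T : TorsionedQDS A m) :
    T ∈ closure (S : Set (TorsionedQDS A m)) := by
  obtain ⟨S', hS'⟩ := exists_coe_eq_closure S
  have hle : ∀ X ∈ S, X ∈ S' := fun X hX => by
    rw [← SetLike.mem_coe, hS']; exact subset_closure hX
  rw [← hS']
  exact mem_of_generators_mem (by rw [hS']; exact isClosed_closure)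
    (fun a i j => hle _ (hu a i j)) (hle _ hs) T

variable {G : Type*} [NormedAddCommGroup G] [InnerProductSpace ℂ G] [CompleteSpace G]
variable (σ : A →⋆ₐ[ℂ] (G →L[ℂ] G))

theorem toOp_mem_range_pairFst (T : TorsionedQDS A m) :
    TorsionedQDS.toOp A m T ∈ Set.range (pairFst (univRep A) σ) := by
  refine mem_of_generators_mem (S := (pairFst (univRep A) σ).range.comap (TorsionedQDS.toOp A m))
    ((isClosed_range_starAlgHom (pairFst (univRep A) σ)).preimage isometry_toOp.continuous)
    (fun a i j => ?_) ?_ T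
  · exact ⟨⟨_, unitOp_mem_stabilizer_entryPairs (univRep A) σ a i j⟩, rfl⟩
  · exact ⟨⟨_, shiftPow_mem_stabilizer_entryPairs (univRep A) σ m⟩, rfl⟩

variable (m) in
/-- The representation of `Σ²_m A` on `G ⊗ ℓ²(ℕ)` induced by a representation of `A` on `G`. -/
def suspensionRep : TorsionedQDS A m →⋆ₐ[ℂ] (Seq G →L[ℂ] Seq G) :=
  (pairSnd (univRep A) σ).comp (factorThroughUnital (pairFst (univRep A) σ)
    (pairFst_injective σ univRep_injective) (TorsionedQDS.toOp A m) (toOp_mem_range_pairFst σ))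

/-- The induced representation acts entrywise. -/
theorem exists_entry_suspensionRep (T : TorsionedQDS A m) (i j : ℕ) :
    ∃ a, univRep A a = entry i j (TorsionedQDS.toOp A m T) ∧
      σ a = entry i j (suspensionRep m σ T) := by
  obtain ⟨a, ha, ha'⟩ := exists_entry_pair (univRep A) σ
    (factorThroughUnital (pairFst (univRep A) σ) (pairFst_injective σ univRep_injective)
      (TorsionedQDS.toOp A m) (toOp_mem_range_pairFst σ) T) i j
  exact ⟨a, by rw [ha, apply_factorThroughUnital], ha'⟩

theorem exists_entry_eq (T : TorsionedQDS A m) (i j : ℕ) :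
    ∃ a, univRep A a = entry i j (TorsionedQDS.toOp A m T) :=
  (exists_entry_suspensionRep (univRep A) T i j).imp fun _ => And.left

theorem entry_suspensionRep {T : TorsionedQDS A m} {i j : ℕ} {a : A}
    (h : univRep A a = entry i j (TorsionedQDS.toOp A m T)) :
    entry i j (suspensionRep m σ T) = σ a := by
  obtain ⟨a', ha, ha'⟩ := exists_entry_suspensionRep σ T i j
  rw [← ha', univRep_injective (h.trans ha.symm)]

theorem suspensionRep_qdsUnit (a : A) (i j : ℕ) :
    suspensionRep m σ (qdsUnit m a i j) = unitOp (σ a) i j := by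
  refine op_ext fun k l => ?_
  rw [entry_suspensionRep σ (a := if k = i ∧ l = j then a else 0), entry_unitOp]
  · split_ifs <;> simp
  · rw [toOp_qdsUnit, entry_unitOp]; split_ifs <;> simp

theorem suspensionRep_qdsShift : suspensionRep m σ (qdsShift A m) = shiftPow G m := by
  refine op_ext fun i j => ?_
  rw [entry_suspensionRep σ (a := if (i : ℤ) - j = m then 1 else 0), entry_shiftPow]
  · split_ifs <;> simp
  · rw [toOp_qdsShift, entry_shiftPow]; split_ifs <;> simp

theorem norm_suspensionRep_le (T : TorsionedQDS A m) : ‖suspensionRep m σ T‖ ≤ ‖T‖ :=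
  NonUnitalStarAlgHom.norm_apply_le _ _

end SuspensionRep

section SuspensionHom

variable {A B : Type*} [CStarAlgebra A] [CStarAlgebra B] {m : ℤ} (α : B →⋆ₐ[ℂ] A)

theorem suspensionRep_mem_torsionedQDS (T : TorsionedQDS B m) :
    suspensionRep m ((univRep A).comp α) T ∈ torsionedQDS A m := by
  have hcl : IsClosed (torsionedQDS A m : Set (Seq (UnivSpace A) →L[ℂ] Seq (UnivSpace A))) :=
    inferInstance
  refine mem_of_generators_mem
    (S := (torsionedQDS A m).comap (suspensionRep m ((univRep A).comp α)))
    (hcl.preimage (continuous_starAlgHom (suspensionRep m ((univRep A).comp α))))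
    (fun b i j => ?_) ?_ T
  · rw [StarSubalgebra.mem_comap, suspensionRep_qdsUnit]
    exact (qdsUnit m (α b) i j).2
  · rw [StarSubalgebra.mem_comap, suspensionRep_qdsShift]
    exact (qdsShift A m).2

variable (m) in
/-- The *-homomorphism `Σ²_m α : Σ²_m B → Σ²_m A`. -/
def suspensionHom : TorsionedQDS B m →⋆ₐ[ℂ] TorsionedQDS A m :=
  (suspensionRep m ((univRep A).comp α)).codRestrict (torsionedQDS A m)
    (suspensionRep_mem_torsionedQDS α)

theorem suspensionHom_qdsUnit (b : B) (i j : ℕ) :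
    suspensionHom m α (qdsUnit m b i j) = qdsUnit m (α b) i j :=
  toOp_injective (suspensionRep_qdsUnit ((univRep A).comp α) b i j)

theorem suspensionHom_qdsShift : suspensionHom m α (qdsShift B m) = qdsShift A m :=
  toOp_injective (suspensionRep_qdsShift ((univRep A).comp α))

theorem isSuspensionHom_suspensionHom : IsSuspensionHom m α (suspensionHom m α) :=
  ⟨suspensionHom_qdsUnit α, suspensionHom_qdsShift α⟩

theorem entry_suspensionHom {T : TorsionedQDS B m} {i j : ℕ} {b : B}
    (h : univRep B b = entry i j (TorsionedQDS.toOp B m T)) :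
    entry i j (TorsionedQDS.toOp A m (suspensionHom m α T)) = univRep A (α b) :=
  entry_suspensionRep ((univRep A).comp α) h

theorem suspensionHom_surjective (hα : Function.Surjective α) :
    Function.Surjective (suspensionHom m α) := by
  refine fun T => mem_of_generators_mem (S := (suspensionHom m α).range)
    (isClosed_range_starAlgHom (suspensionHom m α)) (fun a i j => ?_) ?_ T
  · obtain ⟨b, rfl⟩ := hα a
    exact ⟨_, suspensionHom_qdsUnit α b i j⟩
  · exact ⟨_, suspensionHom_qdsShift α⟩

end SuspensionHom

/-! ### The kernel of a suspended homomorphism -/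

section Toeplitz

variable {E : Type*} [CStarAlgebra E]
variable {G : Type*} [NormedAddCommGroup G] [InnerProductSpace ℂ G] [CompleteSpace G]

variable (G) in
/-- The operator `1 ⊗ T_p`, where `T_p` is the Toeplitz operator whose symbol is the Laurent
polynomial `p`. -/
def toeplitz (p : ℤ →₀ ℂ) : Seq G →L[ℂ] Seq G := Finsupp.linearCombination ℂ (shiftPow G) p

theorem entry_toeplitz (p : ℤ →₀ ℂ) (i j : ℕ) :
    entry i j (toeplitz G p) = p (i - j) • (1 : G →L[ℂ] G) := by
  rw [toeplitz, Finsupp.linearCombination_apply, Finsupp.sum, map_sum]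
  simp only [map_smul, entry_shiftPow, smul_ite, smul_zero]
  rw [Finset.sum_ite_eq]
  split_ifs with h
  · rfl
  · rw [Finsupp.notMem_support_iff.1 h, zero_smul]

/-- The norm of `1 ⊗ T_p` on `G ⊗ ℓ²(ℕ)` is independent of the Hilbert space `G ≠ 0`, because the
operators have the same scalar entries: compare the representations of `ℂ` on `G` and `G'`. -/
theorem norm_toeplitz_le [Nontrivial G] {G' : Type*} [NormedAddCommGroup G']
    [InnerProductSpace ℂ G'] [CompleteSpace G'] (p : ℤ →₀ ℂ) :
    ‖toeplitz G' p‖ ≤ ‖toeplitz G p‖ := by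
  let π : ℂ →⋆ₐ[ℂ] (G →L[ℂ] G) := StarAlgHom.ofId ℂ _
  let σ : ℂ →⋆ₐ[ℂ] (G' →L[ℂ] G') := StarAlgHom.ofId ℂ _
  have hπ : Function.Injective π := (algebraMap ℂ (G →L[ℂ] G)).injective
  have h : Finsupp.linearCombination ℂ (fun k => (shiftPow G k, shiftPow G' k)) p ∈
      stabilizer (entryPairs π σ) :=
    sum_mem fun k _ => SMulMemClass.smul_mem _ (shiftPow_mem_stabilizer_entryPairs π σ k)
  have h1 := norm_snd_le_of_mem_stabilizer σ hπ h
  have e1 : (Finsupp.linearCombination ℂ (fun k => (shiftPow G k, shiftPow G' k)) p).1 =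
      toeplitz G p := by
    rw [toeplitz, Finsupp.linearCombination_apply, Finsupp.linearCombination_apply, Finsupp.sum,
      Finsupp.sum, Prod.fst_sum]
    rfl
  have e2 : (Finsupp.linearCombination ℂ (fun k => (shiftPow G k, shiftPow G' k)) p).2 =
      toeplitz G' p := by
    rw [toeplitz, Finsupp.linearCombination_apply, Finsupp.linearCombination_apply, Finsupp.sum,
      Finsupp.sum, Prod.snd_sum]
    rfl
  rwa [e1, e2] at h1

theorem norm_leftShift_le : ‖leftShift G‖ ≤ 1 := LinearMap.mkContinuous_norm_le _ zero_le_one _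

/-- Compression by `S^n` deletes the first `n` rows and columns. -/
theorem entry_compress (n i j : ℕ) (T : Seq G →L[ℂ] Seq G) :
    entry i j (leftShift G ^ n * T * star (leftShift G) ^ n) = entry (i + n) (j + n) T := by
  induction n generalizing T with
  | zero => simp
  | succ n ih =>
    have h : leftShift G ^ (n + 1) * T * star (leftShift G) ^ (n + 1) =
        leftShift G ^ n * (leftShift G * T * star (leftShift G)) * star (leftShift G) ^ n := by
      rw [pow_succ, pow_succ']; simp only [mul_assoc]
    rw [h, ih, entry_mul_star_leftShift, entry_leftShift_mul]
    rfl

theorem norm_compress_le (n : ℕ) (T : Seq G →L[ℂ] Seq G) :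
    ‖leftShift G ^ n * T * star (leftShift G) ^ n‖ ≤ ‖T‖ := by
  induction n generalizing T with
  | zero => simp
  | succ n ih =>
    have h : leftShift G ^ (n + 1) * T * star (leftShift G) ^ (n + 1) =
        leftShift G ^ n * (leftShift G * T * star (leftShift G)) * star (leftShift G) ^ n := by
      rw [pow_succ, pow_succ']; simp only [mul_assoc]
    rw [h]
    refine (ih _).trans ?_
    have h1 := norm_mul_le (leftShift G * T) (star (leftShift G))
    have h2 := norm_mul_le (leftShift G) T
    have h4 : ‖star (leftShift G)‖ = ‖leftShift G‖ :=
      ContinuousLinearMap.adjoint.norm_map _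
    rw [h4] at h1
    have h3 := norm_leftShift_le (G := G)
    nlinarith [norm_nonneg T, norm_nonneg (leftShift G * T), norm_nonneg (leftShift G)]

variable (π : E →⋆ₐ[ℂ] (G →L[ℂ] G))

/-- The linear span of the operators `π(e) ⊗ p_{ij}` and of all powers `1 ⊗ (S*)^k`, `k ∈ ℤ`. -/
def toeplitzSpan : Submodule ℂ (Seq G →L[ℂ] Seq G) :=
  Submodule.span ℂ (Set.range (shiftPow G) ∪ {T | ∃ (e : E) (i j : ℕ), T = unitOp (π e) i j})

theorem shiftPow_mem_toeplitzSpan (k : ℤ) : shiftPow G k ∈ toeplitzSpan π :=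
  Submodule.subset_span (Or.inl ⟨k, rfl⟩)

theorem unitOp_mem_toeplitzSpan (e : E) (i j : ℕ) : unitOp (π e) i j ∈ toeplitzSpan π :=
  Submodule.subset_span (Or.inr ⟨e, i, j, rfl⟩)

theorem one_mem_toeplitzSpan : 1 ∈ toeplitzSpan π := by
  have h := shiftPow_mem_toeplitzSpan π 0
  rwa [shiftPow, if_pos le_rfl, Int.toNat_zero, pow_zero] at h

theorem mul_mem_toeplitzSpan {X : Seq G →L[ℂ] Seq G}
    (h1 : ∀ k, X * shiftPow G k ∈ toeplitzSpan π)
    (h2 : ∀ e i j, X * unitOp (π e) i j ∈ toeplitzSpan π) {Z : Seq G →L[ℂ] Seq G}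
    (hZ : Z ∈ toeplitzSpan π) : X * Z ∈ toeplitzSpan π := by
  have hle : toeplitzSpan π ≤ (toeplitzSpan π).comap (LinearMap.mulLeft ℂ X) := by
    refine Submodule.span_le.2 ?_
    rintro _ (⟨k, rfl⟩ | ⟨e, i, j, rfl⟩)
    · exact h1 k
    · exact h2 e i j
  exact hle hZ

theorem leftShift_mul_shiftPow (k : ℤ) : leftShift G * shiftPow G k = shiftPow G (k - 1) := by
  refine op_ext fun i j => ?_
  rw [entry_leftShift_mul, entry_shiftPow, entry_shiftPow]
  congr 1
  push_cast
  exact propext ⟨fun h => by lia, fun h => by lia⟩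

/-- For `l > 0`, `S* S^l` differs from `S^{l-1}` in the one entry that `S* S = 1 - p_{00}` kills. -/
theorem star_leftShift_mul_shiftPow (k : ℤ) : star (leftShift G) * shiftPow G k =
    shiftPow G (k + 1) - if k + 1 ≤ 0 then unitOp 1 0 (-(k + 1)).toNat else 0 := by
  refine op_ext fun i j => ?_
  have h : entry i j (if k + 1 ≤ 0 then unitOp (1 : G →L[ℂ] G) 0 (-(k + 1)).toNat else 0) =
      if i = 0 ∧ (-j : ℤ) = k + 1 then 1 else 0 := by
    by_cases hk : k + 1 ≤ 0
    · rw [if_pos hk, entry_unitOp]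
      congr 1
      exact propext ⟨fun h => by lia, fun h => by lia⟩
    · rw [if_neg hk, if_neg (by lia), map_zero]
  rw [map_sub, h, entry_shiftPow]
  cases i with
  | zero =>
    rw [entry_star_leftShift_mul_zero]
    by_cases hj : (-j : ℤ) = k + 1
    · rw [if_pos (by simpa using hj), if_pos ⟨rfl, hj⟩, sub_self]
    · rw [if_neg (by simpa using hj), if_neg (by simp [hj]), sub_self]
  | succ i =>
    rw [entry_star_leftShift_mul_succ, entry_shiftPow, if_neg (c := _ ∧ _) (by simp), sub_zero]
    congr 1
    push_cast
    exact propext ⟨fun h => by lia, fun h => by lia⟩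

theorem unitOp_mul_shiftPow (X : G →L[ℂ] G) (i j : ℕ) (k : ℤ) : unitOp X i j * shiftPow G k =
    if 0 ≤ j - k then unitOp X i (j - k).toNat else 0 := by
  refine op_ext fun r s => ?_
  rw [entry_unitOp_mul, entry_shiftPow]
  by_cases hr : r = i
  · subst hr
    by_cases hjk : 0 ≤ (j : ℤ) - k
    · rw [if_pos hjk, if_pos rfl, entry_unitOp]
      by_cases hs : (j : ℤ) - s = k
      · rw [if_pos hs, if_pos ⟨rfl, by lia⟩, mul_one]
      · rw [if_neg hs, if_neg (by lia), mul_zero]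
    · rw [if_neg hjk, if_pos rfl, if_neg (by lia), mul_zero, map_zero]
  · rw [if_neg hr]
    split_ifs
    · rw [entry_unitOp, if_neg (by simp [hr])]
    · rw [map_zero]

theorem leftShift_mem_stabilizer_toeplitzSpan :
    leftShift G ∈ stabilizer (toeplitzSpan π) := by
  refine fun Z hZ => ⟨mul_mem_toeplitzSpan π (fun k => ?_) (fun e i j => ?_) hZ,
    mul_mem_toeplitzSpan π (fun k => ?_) (fun e i j => ?_) hZ⟩
  · rw [leftShift_mul_shiftPow]
    exact shiftPow_mem_toeplitzSpan π _
  · cases i with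
    | zero => rw [leftShift_mul_unitOp_zero]; exact zero_mem _
    | succ i => rw [leftShift_mul_unitOp_succ]; exact unitOp_mem_toeplitzSpan π e i j
  · rw [star_leftShift_mul_shiftPow]
    refine sub_mem (shiftPow_mem_toeplitzSpan π _) ?_
    split_ifs
    · rw [← map_one π]; exact unitOp_mem_toeplitzSpan π _ _ _
    · exact zero_mem _
  · rw [star_leftShift_mul_unitOp]
    exact unitOp_mem_toeplitzSpan π e _ j

theorem unitOp_mem_stabilizer_toeplitzSpan (e : E) (i j : ℕ) :
    unitOp (π e) i j ∈ stabilizer (toeplitzSpan π) := by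
  have key : ∀ (e : E) (i j : ℕ), ∀ Z ∈ toeplitzSpan π, unitOp (π e) i j * Z ∈ toeplitzSpan π := by
    refine fun e i j Z hZ => mul_mem_toeplitzSpan π (fun k => ?_) (fun f k l => ?_) hZ
    · rw [unitOp_mul_shiftPow]
      split_ifs
      · exact unitOp_mem_toeplitzSpan π _ _ _
      · exact zero_mem _
    · rw [unitOp_mul_unitOp, ← map_mul]
      split_ifs
      · exact unitOp_mem_toeplitzSpan π _ _ _
      · exact zero_mem _
  refine fun Z hZ => ⟨key e i j Z hZ, ?_⟩
  rw [star_unitOp, ← map_star]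
  exact key _ _ _ Z hZ

theorem shiftPow_mem_stabilizer_toeplitzSpan (m : ℤ) :
    shiftPow G m ∈ stabilizer (toeplitzSpan π) := by
  have h := leftShift_mem_stabilizer_toeplitzSpan π
  unfold shiftPow
  split_ifs
  · exact pow_mem (star_mem h) _
  · exact pow_mem h _

/-- Outside a finite corner, the entries of an element of `toeplitzSpan π` are those of a scalar
Toeplitz operator. -/
theorem exists_toeplitz_of_mem {T : Seq G →L[ℂ] Seq G} (hT : T ∈ toeplitzSpan π) :
    ∃ (p : ℤ →₀ ℂ) (N : ℕ), ∀ i j, N ≤ i ∨ N ≤ j →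
      entry i j T = p (i - j) • (1 : G →L[ℂ] G) := by
  induction hT using Submodule.span_induction with
  | mem T hT =>
    obtain ⟨k, rfl⟩ | ⟨e, i, j, rfl⟩ := hT
    · refine ⟨Finsupp.single k 1, 0, fun i j _ => ?_⟩
      rw [entry_shiftPow, Finsupp.single_apply]
      by_cases h : (i : ℤ) - j = k
      · rw [if_pos h, if_pos h.symm, one_smul]
      · rw [if_neg h, if_neg (Ne.symm h), zero_smul]
    · refine ⟨0, max i j + 1, fun k l h => ?_⟩
      rw [entry_unitOp, if_neg (by lia), Finsupp.zero_apply, zero_smul]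
  | zero => exact ⟨0, 0, fun i j _ => by simp⟩
  | add T T' _ _ hT hT' =>
    obtain ⟨p, N, hp⟩ := hT
    obtain ⟨p', N', hp'⟩ := hT'
    refine ⟨p + p', max N N', fun i j h => ?_⟩
    rw [map_add, hp i j (by lia), hp' i j (by lia), Finsupp.add_apply, add_smul]
  | smul c T _ hT =>
    obtain ⟨p, N, hp⟩ := hT
    refine ⟨c • p, N, fun i j h => ?_⟩
    rw [map_smul, hp i j h, Finsupp.smul_apply, smul_assoc]

theorem eq_sum_unitOp {T : Seq G →L[ℂ] Seq G} {N : ℕ}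
    (h : ∀ i j, N ≤ i ∨ N ≤ j → entry i j T = 0) :
    T = ∑ i ∈ Finset.range N, ∑ j ∈ Finset.range N, unitOp (entry i j T) i j := by
  refine op_ext fun k l => ?_
  simp only [map_sum, entry_unitOp]
  by_cases hkl : k < N ∧ l < N
  · rw [Finset.sum_eq_single k, Finset.sum_eq_single l]
    · simp
    · intro j _ hj; simp [hj.symm]
    · intro hl; simp at hl; lia
    · intro i _ hi; simp [hi.symm]
    · intro hk; simp at hk; lia
  · rw [h k l (by lia), Finset.sum_eq_zero]
    intro i hi
    refine Finset.sum_eq_zero fun j hj => ?_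
    simp only [Finset.mem_range] at hi hj
    rw [if_neg (by lia)]

end Toeplitz

section Kernel

variable {A B : Type*} [CStarAlgebra A] [CStarAlgebra B] {m : ℤ} {α : B →⋆ₐ[ℂ] A}

theorem mem_closure_toeplitzSpan (T : TorsionedQDS B m) :
    T ∈ closure {T' : TorsionedQDS B m |
      TorsionedQDS.toOp B m T' ∈ toeplitzSpan (univRep B)} := by
  refine closure_mono (fun T' hT' => ?_) (mem_closure_of_generators_mem
    (S := (stabilizer (toeplitzSpan (univRep B))).comap (TorsionedQDS.toOp B m))
    (unitOp_mem_stabilizer_toeplitzSpan (univRep B))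
    (shiftPow_mem_stabilizer_toeplitzSpan (univRep B) m) T)
  exact mem_of_mem_stabilizer (one_mem_toeplitzSpan _) hT'

/-- If `A ≠ 0`, the kernel of `Σ²_m α` is contained in `B ⊗ K`. An element `T'` of the algebraic
span has the form `1 ⊗ T_p` plus a finite corner, and compressing its image by a power of the shift
bounds the norm of `1 ⊗ T_p` by that of the image. -/
theorem toOp_mem_stabilization [Nontrivial A] {T : TorsionedQDS B m}
    (hT : suspensionHom m α T = 0) : TorsionedQDS.toOp B m T ∈ stabilization B := by
  have : Nontrivial (UnivSpace A) := by
    have h : Nontrivial (UnivSpace A →L[ℂ] UnivSpace A) := univRep_injective.nontrivial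
    by_contra hn
    rw [not_nontrivial_iff_subsingleton] at hn
    exact not_subsingleton (UnivSpace A →L[ℂ] UnivSpace A) inferInstance
  refine Metric.mem_closure_iff.2 fun ε hε => ?_
  obtain ⟨T', hT', hd⟩ :=
    Metric.mem_closure_iff.1 (mem_closure_toeplitzSpan T) (ε / 2) (half_pos hε)
  obtain ⟨p, N, hp⟩ := exists_toeplitz_of_mem _ hT'
  have hnorm : ‖suspensionHom m α T'‖ ≤ ε / 2 := by
    have h1 : suspensionHom m α T' = suspensionHom m α (T' - T) := by rw [map_sub, hT, sub_zero]
    rw [h1]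
    refine (NonUnitalStarAlgHom.norm_apply_le _ _).trans ?_
    rw [← dist_eq_norm, dist_comm]
    exact hd.le
  -- The compression removes the finite corner; Toeplitz entries are invariant under it.
  have hA : toeplitz (UnivSpace A) p = leftShift (UnivSpace A) ^ N *
      TorsionedQDS.toOp A m (suspensionHom m α T') * star (leftShift (UnivSpace A)) ^ N := by
    refine op_ext fun i j => ?_
    rw [entry_toeplitz, entry_compress, entry_suspensionHom α
      (b := p ((i + N : ℕ) - (j + N : ℕ)) • 1)]
    · rw [map_smul, map_smul, map_one, map_one]
      congr 2
      push_cast; ring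
    · rw [hp _ _ (Or.inl (Nat.le_add_left _ _)), map_smul, map_one]
  have hB : ‖toeplitz (UnivSpace B) p‖ ≤ ε / 2 := by
    refine (norm_toeplitz_le (G := UnivSpace A) p).trans ?_
    rw [hA]
    exact (norm_compress_le _ _).trans hnorm
  refine ⟨TorsionedQDS.toOp B m T' - toeplitz (UnivSpace B) p, ?_, ?_⟩
  · rw [eq_sum_unitOp (N := N) (T := TorsionedQDS.toOp B m T' - toeplitz (UnivSpace B) p)]
    · refine sum_mem fun i _ => sum_mem fun j _ => Submodule.subset_span ?_
      obtain ⟨b, hb⟩ := exists_entry_eq T' i j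
      refine ⟨b - p (i - j) • 1, i, j, ?_⟩
      rw [map_sub, map_sub, map_smul, map_one, entry_toeplitz, hb]
    · intro i j hij
      rw [map_sub, hp i j hij, entry_toeplitz, sub_self]
  · rw [dist_eq_norm, ← sub_add, ← map_sub]
    refine (norm_add_le _ _).trans_lt ?_
    rw [norm_toOp, ← dist_eq_norm]
    linarith

end Kernel

/-! ### Approximation by finite matrices -/

section Truncation

variable {G : Type*} [NormedAddCommGroup G] [InnerProductSpace ℂ G]

variable (G) in
/-- The projection of `G ⊗ ℓ²(ℕ)` onto the first `n` coordinates. -/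
def trunc (n : ℕ) : Seq G →L[ℂ] Seq G := ∑ i ∈ Finset.range n, unitOp 1 i i

theorem trunc_apply (n : ℕ) (x : Seq G) :
    trunc G n x = ∑ i ∈ Finset.range n, lp.single 2 i (x i) := by
  rw [trunc, sum_apply]
  rfl

theorem tendsto_trunc (x : Seq G) :
    Filter.Tendsto (fun n => trunc G n x) Filter.atTop (nhds x) := by
  simp only [trunc_apply]
  exact (lp.hasSum_single (p := 2) (by norm_num) x).tendsto_sum_nat

theorem trunc_mul_mul_trunc (n : ℕ) (T : Seq G →L[ℂ] Seq G) :
    trunc G n * T * trunc G n =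
      ∑ i ∈ Finset.range n, ∑ j ∈ Finset.range n, unitOp (entry i j T) i j := by
  simp only [trunc, Finset.sum_mul, Finset.mul_sum]
  rw [Finset.sum_comm]
  rfl

variable (G) in
/-- The truncations `trunc G n` as a family indexed by `ℕ ∪ {∞}`, with value `1` at `∞`. -/
def truncFamily : OnePoint ℕ → Seq G →L[ℂ] Seq G := fun n => n.elim 1 (trunc G)

theorem continuous_truncFamily_apply (x : Seq G) : Continuous fun n => truncFamily G n x :=
  (OnePoint.continuous_iff_from_nat _).2 (tendsto_trunc x)

variable [CompleteSpace G]

theorem star_truncFamily (n : OnePoint ℕ) : star (truncFamily G n) = truncFamily G n := by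
  induction n using OnePoint.rec with
  | infty => exact star_one (Seq G →L[ℂ] Seq G)
  | coe n =>
    change star (trunc G n) = trunc G n
    rw [trunc, star_sum]
    exact Finset.sum_congr rfl fun i _ => by rw [star_unitOp, star_one]

/-- The truncations are uniformly bounded, as a strongly continuous family on `ℕ ∪ {∞}`. -/
theorem exists_norm_trunc_le : ∃ C, ∀ n, ‖trunc G n‖ ≤ C := by
  obtain ⟨C, hC⟩ := exists_bound (x := truncFamily G) continuous_truncFamily_apply
  exact ⟨C, fun n => hC n⟩

/-- The operators `T` with `P_n T P_n → T` in norm form a closed set, because the truncations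
`P_n` are uniformly bounded. -/
theorem isClosed_tendsto_trunc : IsClosed {T : Seq G →L[ℂ] Seq G |
    Filter.Tendsto (fun n => trunc G n * T * trunc G n) Filter.atTop (nhds T)} := by
  obtain ⟨C, hC⟩ := exists_norm_trunc_le (G := G)
  have hC0 : 0 ≤ C := (norm_nonneg _).trans (hC 0)
  refine isClosed_of_closure_subset fun T hT => Metric.tendsto_atTop.2 fun ε hε => ?_
  obtain ⟨S, hS, hd⟩ := Metric.mem_closure_iff.1 hT (ε / (2 * (1 + C * C))) (by positivity)
  obtain ⟨N, hN⟩ := Metric.tendsto_atTop.1 hS (ε / 2) (half_pos hε)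
  refine ⟨N, fun n hn => ?_⟩
  have h1 := hN n hn
  rw [dist_eq_norm] at h1 hd ⊢
  have h2 : trunc G n * T * trunc G n - T = trunc G n * (T - S) * trunc G n - (T - S) +
      (trunc G n * S * trunc G n - S) := by
    rw [mul_sub, sub_mul]; abel
  have h3 : ‖trunc G n * (T - S) * trunc G n‖ ≤ C * ‖T - S‖ * C := by
    refine (norm_mul_le _ _).trans (mul_le_mul ((norm_mul_le _ _).trans ?_) (hC n)
      (norm_nonneg _) (by positivity))
    exact mul_le_mul_of_nonneg_right (hC n) (norm_nonneg _)
  have h4 : (1 + C * C) * ‖T - S‖ < ε / 2 := by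
    rw [lt_div_iff₀ (by positivity)] at hd
    linarith
  rw [h2]
  have h5 := norm_add_le (trunc G n * (T - S) * trunc G n - (T - S))
    (trunc G n * S * trunc G n - S)
  have h6 := norm_sub_le (trunc G n * (T - S) * trunc G n) (T - S)
  linarith

theorem trunc_mul_unitOp {X : G →L[ℂ] G} {i j n : ℕ} (hi : i < n) :
    trunc G n * unitOp X i j = unitOp X i j := by
  rw [trunc, Finset.sum_mul, Finset.sum_eq_single i]
  · rw [unitOp_mul_unitOp, if_pos rfl, one_mul]
  · intro k _ hk; rw [unitOp_mul_unitOp, if_neg hk]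
  · intro h; exact absurd (Finset.mem_range.2 hi) h

theorem unitOp_mul_trunc {X : G →L[ℂ] G} {i j n : ℕ} (hj : j < n) :
    unitOp X i j * trunc G n = unitOp X i j := by
  rw [trunc, Finset.mul_sum, Finset.sum_eq_single j]
  · rw [unitOp_mul_unitOp, if_pos rfl, mul_one]
  · intro k _ hk; rw [unitOp_mul_unitOp, if_neg hk.symm]
  · intro h; exact absurd (Finset.mem_range.2 hj) h

theorem tendsto_trunc_of_mem_stabilization {A : Type*} [CStarAlgebra A]
    {T : Seq (UnivSpace A) →L[ℂ] Seq (UnivSpace A)} (hT : T ∈ stabilization A) :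
    Filter.Tendsto (fun n => trunc _ n * T * trunc _ n) Filter.atTop (nhds T) := by
  refine closure_minimal (fun S hS => ?_) isClosed_tendsto_trunc hT
  change Filter.Tendsto _ _ _
  induction hS using Submodule.span_induction with
  | mem S hS =>
    obtain ⟨a, i, j, rfl⟩ := hS
    refine tendsto_const_nhds.congr' ?_
    filter_upwards [Filter.eventually_gt_atTop i, Filter.eventually_gt_atTop j] with n hi hj
    rw [trunc_mul_unitOp hi, unitOp_mul_trunc hj]
  | zero => simp
  | add S S' _ _ h h' =>
    simpa only [mul_add, add_mul] using h.add h'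
  | smul c S _ h =>
    simpa only [mul_smul_comm, smul_mul_assoc] using h.const_smul c

end Truncation

section CptFun

variable {Y : Type*} [TopologicalSpace Y] [CompactSpace Y]
variable {H : Type*} [NormedAddCommGroup H] [InnerProductSpace ℂ H] [CompleteSpace H]

/-- The `(i, j)` matrix entry of an element of `C(Y) ⊗ K(H) ⊗ K(ℓ²(ℕ))`. -/
def CptFun.entry (F : CptFun Y (Seq H)) (i j : ℕ) : CptFun Y H :=
  CptFun.mk (fun y => QDS.entry i j (F.val y)) ((QDS.entry i j).continuous.comp F.continuous_val)
    fun y => ((F.isCompactOperator_val y).comp_clm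
      (lp.singleContinuousLinearMap ℂ (fun _ : ℕ => H) 2 j)).clm_comp
        (lp.evalCLM ℂ (fun _ : ℕ => H) 2 i)

/-- Evaluation at `y`, as a *-homomorphism. -/
def CptFun.evalHom (y : Y) : CptFun Y H →⋆ₙₐ[ℂ] (H →L[ℂ] H) where
  toFun f := f.val y
  map_smul' _ _ := rfl
  map_zero' := rfl
  map_add' _ _ := rfl
  map_mul' _ _ := rfl
  map_star' _ := rfl

theorem CptFun.val_sum_tensor (f : ℕ → ℕ → CptFun Y H) (n : ℕ) (y : Y) :
    (∑ i ∈ Finset.range n, ∑ j ∈ Finset.range n, (f i j).tensor i j).val y =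
      ∑ i ∈ Finset.range n, ∑ j ∈ Finset.range n, unitOp ((f i j).val y) i j := by
  change CptFun.evalHom y _ = _
  simp only [map_sum]
  rfl

/-- The truncations of `F` to finite matrices converge to `F`, uniformly on `Y`. Multiplication of
a norm continuous family of compact operators by a strongly continuous family is norm continuous;
this is applied to the truncations, as a strongly continuous family on `(ℕ ∪ {∞}) × Y`. -/
theorem CptFun.tendsto_sum_entry_tensor (F : CptFun Y (Seq H)) :
    Filter.Tendsto (fun n => ∑ i ∈ Finset.range n, ∑ j ∈ Finset.range n, (F.entry i j).tensor i j)
      Filter.atTop (nhds F) := by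
  let x : OnePoint ℕ × Y → Seq H →L[ℂ] Seq H := fun z => truncFamily H z.1
  have hx : ∀ v, Continuous fun z => x z v := fun v =>
    (continuous_truncFamily_apply v).comp continuous_fst
  have h1 : Continuous fun z : OnePoint ℕ × Y => x z ∘L star (F.val z.2) :=
    continuous_comp_cpt hx (continuous_star.comp (F.continuous_val.comp continuous_snd))
      fun z => isCompactOperator_star (F.isCompactOperator_val z.2)
  have h2 : Continuous fun z : OnePoint ℕ × Y => F.val z.2 * x z := by
    refine (continuous_star.comp h1).congr fun z => ?_
    change star (x z * star (F.val z.2)) = _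
    rw [star_mul, star_star, star_truncFamily]
  have h3 : Continuous fun z : OnePoint ℕ × Y => x z * (F.val z.2 * x z) :=
    continuous_comp_cpt hx h2 fun z => (F.isCompactOperator_val z.2).comp_clm (x z)
  let g : C(OnePoint ℕ × Y, Seq H →L[ℂ] Seq H) := ⟨_, h3⟩
  have h4 : Filter.Tendsto (fun n : ℕ => g.curry n) Filter.atTop (nhds (g.curry OnePoint.infty)) :=
    (OnePoint.continuous_iff_from_nat _).1 g.curry.continuous
  rw [ContinuousMap.tendsto_iff_tendstoUniformly, Metric.tendstoUniformly_iff] at h4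
  rw [Metric.tendsto_nhds]
  intro ε hε
  filter_upwards [h4 (ε / 2) (half_pos hε)] with n hn
  rw [dist_eq_norm]
  refine lt_of_le_of_lt (CptFun.norm_le (half_pos hε).le fun y => ?_) (half_lt_self hε)
  change ‖CptFun.evalHom y _‖ ≤ _
  rw [map_sub]
  change ‖CptFun.val _ y - CptFun.val F y‖ ≤ _
  rw [CptFun.val_sum_tensor]
  have h5 : g.curry n y = trunc H n * F.val y * trunc H n := (mul_assoc _ _ _).symm
  have h6 : g.curry OnePoint.infty y = F.val y := by
    change 1 * (F.val y * 1) = F.val y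
    rw [one_mul, mul_one]
  have h7 := (hn y).le
  rw [dist_comm, h5, h6, trunc_mul_mul_trunc, dist_eq_norm] at h7
  exact h7

end CptFun

/-! ### The action on the suspended ideal -/

section StarKer

variable {C D : Type*} [CStarAlgebra C] [CStarAlgebra D]

/-- The kernel of a *-homomorphism, as a non-unital *-subalgebra. -/
def starKer (φ : C →⋆ₐ[ℂ] D) : NonUnitalStarSubalgebra ℂ C where
  carrier := {x | φ x = 0}
  add_mem' {x y} hx hy := by
    change φ (x + y) = 0
    rw [map_add, show φ x = 0 from hx, show φ y = 0 from hy, add_zero]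
  zero_mem' := map_zero φ
  mul_mem' {x y} hx _ := by
    change φ (x * y) = 0
    rw [map_mul, show φ x = 0 from hx, zero_mul]
  smul_mem' c x hx := by
    change φ (c • x) = 0
    rw [map_smul, show φ x = 0 from hx, smul_zero]
  star_mem' {x} hx := by
    change φ (star x) = 0
    rw [map_star, show φ x = 0 from hx, star_zero]

instance (φ : C →⋆ₐ[ℂ] D) : IsClosed (starKer φ : Set C) :=
  isClosed_singleton.preimage (continuous_starAlgHom φ)

/-- The kernel of a *-homomorphism, as a C*-algebra. -/
def StarKer (φ : C →⋆ₐ[ℂ] D) : Type _ := starKer φ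

instance (φ : C →⋆ₐ[ℂ] D) : NonUnitalCStarAlgebra (StarKer φ) :=
  NonUnitalStarSubalgebra.nonUnitalCStarAlgebra (starKer φ)

/-- The inclusion of the kernel. -/
def starKerIncl (φ : C →⋆ₐ[ℂ] D) : StarKer φ →⋆ₙₐ[ℂ] C :=
  NonUnitalStarSubalgebraClass.subtype (starKer φ)

theorem starKerIncl_injective (φ : C →⋆ₐ[ℂ] D) : Function.Injective (starKerIncl φ) :=
  Subtype.val_injective

theorem apply_starKerIncl (φ : C →⋆ₐ[ℂ] D) (x : StarKer φ) : φ (starKerIncl φ x) = 0 := x.2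

theorem exists_starKerIncl_eq {φ : C →⋆ₐ[ℂ] D} {x : C} (hx : φ x = 0) :
    ∃ z, starKerIncl φ z = x := ⟨⟨x, hx⟩, rfl⟩

end StarKer

variable {Y : Type*} [TopologicalSpace Y] [CompactSpace Y]
variable {H : Type*} [NormedAddCommGroup H] [InnerProductSpace ℂ H] [CompleteSpace H]
variable {A B : Type*} [CStarAlgebra A] [CStarAlgebra B]

section SuspensionMult

variable (m : ℤ) (μ : B →⋆ₐ[ℂ] Mult Y H)

/-- The representation of `B` on `H` obtained from `μ : B → M(Y)` by evaluation at `y`. -/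
def evalRep (y : Y) : B →⋆ₐ[ℂ] (H →L[ℂ] H) where
  toFun b := (μ b : Y → H →L[ℂ] H) y
  map_one' := by rw [map_one]; rfl
  map_mul' a b := by rw [map_mul]; rfl
  map_zero' := by rw [map_zero]; rfl
  map_add' a b := by rw [map_add]; rfl
  commutes' r := by rw [AlgHomClass.commutes]; rfl
  map_star' b := by rw [map_star]; rfl

/-- The field of representations of `Σ²_m B` over `Y` induced by `μ : B → M(Y)`. -/
def suspensionField : TorsionedQDS B m →⋆ₐ[ℂ] (Y → Seq H →L[ℂ] Seq H) where
  toFun T y := suspensionRep m (evalRep μ y) T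
  map_one' := funext fun _ => map_one _
  map_mul' _ _ := funext fun _ => map_mul _ _ _
  map_zero' := funext fun _ => map_zero _
  map_add' _ _ := funext fun _ => map_add _ _ _
  commutes' r := funext fun y => AlgHomClass.commutes (suspensionRep m (evalRep μ y)) r
  map_star' _ := funext fun _ => map_star _ _

variable {m}

theorem suspensionField_apply (T : TorsionedQDS B m) (y : Y) :
    suspensionField m μ T y = suspensionRep m (evalRep μ y) T := rfl

theorem suspensionField_qdsUnit (b : B) (i j : ℕ) :
    suspensionField m μ (qdsUnit m b i j) = (multTensor (μ b) i j : Y → Seq H →L[ℂ] Seq H) :=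
  funext fun y => suspensionRep_qdsUnit (evalRep μ y) b i j

theorem suspensionField_qdsShift :
    suspensionField m μ (qdsShift B m) = (multShift Y H m : Y → Seq H →L[ℂ] Seq H) :=
  funext fun y => suspensionRep_qdsShift (evalRep μ y)

theorem norm_suspensionField_sub_le (T T' : TorsionedQDS B m) (y : Y) :
    ‖suspensionField m μ T y - suspensionField m μ T' y‖ ≤ ‖T - T'‖ := by
  rw [suspensionField_apply, suspensionField_apply, ← map_sub]
  exact norm_suspensionRep_le _ _

theorem isClosed_continuous_suspensionField_apply (v : Seq H) :
    IsClosed {T : TorsionedQDS B m | Continuous fun y => suspensionField m μ T y v} := by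
  refine isClosed_of_closure_subset fun T hT => ?_
  refine continuous_of_uniform_approx_of_continuous fun u hu => ?_
  obtain ⟨ε, hε, hu⟩ := Metric.mem_uniformity_dist.1 hu
  obtain ⟨T', hT', hd⟩ := Metric.mem_closure_iff.1 hT (ε / (‖v‖ + 1)) (by positivity)
  refine ⟨_, hT', fun y => hu ?_⟩
  rw [dist_eq_norm] at hd ⊢
  change ‖(suspensionField m μ T y - suspensionField m μ T' y) v‖ < ε
  have h1 := (suspensionField m μ T y - suspensionField m μ T' y).le_of_opNorm_le
    (norm_suspensionField_sub_le μ T T' y) v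
  rw [lt_div_iff₀ (by positivity)] at hd
  nlinarith [norm_nonneg (T - T'), norm_nonneg v]

theorem suspensionField_mem (T : TorsionedQDS B m) : suspensionField m μ T ∈ Mult Y (Seq H) := by
  have h : ∀ T : TorsionedQDS B m, T ∈ closure ((Mult Y (Seq H)).comap (suspensionField m μ) :
      Set (TorsionedQDS B m)) := by
    refine mem_closure_of_generators_mem (fun b i j => ?_) ?_
    · rw [StarSubalgebra.mem_comap, suspensionField_qdsUnit]
      exact (multTensor (μ b) i j).2
    · rw [StarSubalgebra.mem_comap, suspensionField_qdsShift]
      exact (multShift Y H m).2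
  have h1 : ∀ (T : TorsionedQDS B m) (v), Continuous fun y => suspensionField m μ T y v :=
    fun T v => closure_minimal (fun T' hT' => hT'.1 v)
      (isClosed_continuous_suspensionField_apply μ v) (h T)
  refine ⟨h1 T, fun v => ?_⟩
  have h2 := h1 (star T) v
  rwa [map_star] at h2

variable (m) in
/-- The *-homomorphism `Σ²_m B → M(C(Y) ⊗ K(H) ⊗ K(ℓ²(ℕ)))` induced by `μ : B → M(Y)`. -/
def suspensionMult : TorsionedQDS B m →⋆ₐ[ℂ] Mult Y (Seq H) :=
  (suspensionField m μ).codRestrict (Mult Y (Seq H)) (suspensionField_mem μ)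

theorem coe_suspensionMult (T : TorsionedQDS B m) :
    (suspensionMult m μ T : Y → Seq H →L[ℂ] Seq H) = suspensionField m μ T := rfl

theorem suspensionMult_qdsUnit (b : B) (i j : ℕ) :
    suspensionMult m μ (qdsUnit m b i j) = multTensor (μ b) i j :=
  Subtype.ext (suspensionField_qdsUnit μ b i j)

theorem suspensionMult_qdsShift : suspensionMult m μ (qdsShift B m) = multShift Y H m :=
  Subtype.ext (suspensionField_qdsShift μ)

theorem entry_suspensionMult {T : TorsionedQDS B m} {i j : ℕ} {b : B}
    (h : univRep B b = entry i j (TorsionedQDS.toOp B m T)) (y : Y) :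
    entry i j ((suspensionMult m μ T : Y → Seq H →L[ℂ] Seq H) y) = (μ b : Y → H →L[ℂ] H) y :=
  entry_suspensionRep (evalRep μ y) h

/-- The elements of `Σ²_m B` that are mapped into `C(Y) ⊗ K(H) ⊗ K(ℓ²(ℕ))` form a closed set. -/
theorem isClosed_suspensionMult_mem_range :
    IsClosed {T : TorsionedQDS B m | ∃ F : CptFun Y (Seq H), toMult F = suspensionMult m μ T} := by
  refine isClosed_of_closure_subset fun T hT => ?_
  have happ : ∀ ε > 0, ∃ F : CptFun Y (Seq H),
      ∀ y, dist (suspensionField m μ T y) (F.val y) < ε := by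
    intro ε hε
    obtain ⟨T', ⟨F, hF⟩, hd⟩ := Metric.mem_closure_iff.1 hT ε hε
    refine ⟨F, fun y => ?_⟩
    rw [← coe_toMult, hF, coe_suspensionMult]
    rw [dist_eq_norm] at hd ⊢
    exact (norm_suspensionField_sub_le μ T T' y).trans_lt hd
  have hcont : Continuous (suspensionField m μ T) := by
    refine continuous_of_uniform_approx_of_continuous fun u hu => ?_
    obtain ⟨ε, hε, hu⟩ := Metric.mem_uniformity_dist.1 hu
    obtain ⟨F, hF⟩ := happ ε hε
    exact ⟨F.val, F.continuous_val, fun y => hu (hF y)⟩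
  have hcpt : ∀ y, IsCompactOperator (suspensionField m μ T y) := by
    intro y
    have hcl : IsClosed (Cpt (Seq H) : Set (Seq H →L[ℂ] Seq H)) := inferInstance
    refine hcl.closure_subset (Metric.mem_closure_iff.2 fun ε hε => ?_)
    obtain ⟨F, hF⟩ := happ ε hε
    exact ⟨F.val y, F.isCompactOperator_val y, hF y⟩
  exact ⟨CptFun.mk _ hcont hcpt, rfl⟩

end SuspensionMult

section Suspension

variable {m : ℤ} (ξ : CStarExtension (CptFun Y H) B A)

theorem multTensor_toMult (f : CptFun Y H) (i j : ℕ) :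
    multTensor (toMult f) i j = toMult (f.tensor i j) := rfl

theorem suspensionMult_qdsUnit_incl (f : CptFun Y H) (i j : ℕ) :
    suspensionMult m ξ.multiplier (qdsUnit m (ξ.incl f) i j) = toMult (f.tensor i j) := by
  rw [suspensionMult_qdsUnit, ξ.multiplier_incl, multTensor_toMult]

theorem suspensionHom_qdsUnit_incl (f : CptFun Y H) (i j : ℕ) :
    suspensionHom m ξ.proj (qdsUnit m (ξ.incl f) i j) = 0 := by
  rw [suspensionHom_qdsUnit, (ξ.proj_eq_zero_iff _).2 ⟨f, rfl⟩]
  refine toOp_injective (op_ext fun k l => ?_)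
  rw [toOp_qdsUnit, map_zero, map_zero, entry_unitOp]
  simp

/-- The entries of an element of the kernel of `Σ²_m α` lie in the ideal `C(Y) ⊗ K(H)`. -/
theorem exists_entry_eq_incl {T : TorsionedQDS B m} (hT : suspensionHom m ξ.proj T = 0) (i j : ℕ) :
    ∃ f, univRep B (ξ.incl f) = entry i j (TorsionedQDS.toOp B m T) := by
  obtain ⟨b, hb⟩ := exists_entry_eq T i j
  have h1 := entry_suspensionHom ξ.proj hb
  rw [hT, map_zero, map_zero, eq_comm, map_eq_zero_iff _ univRep_injective] at h1
  obtain ⟨f, rfl⟩ := (ξ.proj_eq_zero_iff _).1 h1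
  exact ⟨f, hb⟩

/-- The kernel of `Σ²_m α` acts faithfully on `C(Y) ⊗ K(H) ⊗ K(ℓ²(ℕ))`. -/
theorem eq_zero_of_suspensionMult_eq_zero {T : TorsionedQDS B m}
    (hT : suspensionHom m ξ.proj T = 0) (h : suspensionMult m ξ.multiplier T = 0) : T = 0 := by
  refine toOp_injective (op_ext fun i j => ?_)
  obtain ⟨f, hf⟩ := exists_entry_eq_incl ξ hT i j
  have h1 : f = 0 := by
    refine CptFun.ext (funext fun y => ?_)
    have h2 := entry_suspensionMult ξ.multiplier hf y
    rw [h, ξ.multiplier_incl] at h2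
    exact h2.symm.trans (map_zero (entry i j))
  rw [← hf, h1, map_zero, map_zero, map_zero, map_zero]

/-- If `A = 0`, then `C(Y) ⊗ K(H)` is unital, so `Y` is empty because `H` is infinite-dimensional;
hence `B = 0`. -/
theorem subsingleton_of_subsingleton (ξ : CStarExtension (CptFun Y H) B A)
    (hH : ¬ FiniteDimensional ℂ H) [Subsingleton A] :
    Subsingleton B := by
  obtain ⟨f, hf⟩ := (ξ.proj_eq_zero_iff 1).1 (Subsingleton.elim _ _)
  have hY : IsEmpty Y := by
    refine ⟨fun y => hH ?_⟩
    have h1 : toMult f = 1 := by rw [← ξ.multiplier_incl, hf, map_one]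
    have h2 : f.val y = 1 := congrArg (fun z : Mult Y H => (z : Y → H →L[ℂ] H) y) h1
    have h3 := f.isCompactOperator_val y
    rw [h2] at h3
    have h4 : LocallyCompactSpace H := isCompactOperator_id_iff_locallyCompactSpace.1 h3
    exact FiniteDimensional.of_locallyCompactSpace ℂ
  have h0 : f = 0 := CptFun.ext (funext fun y => isEmptyElim y)
  rw [h0, map_zero] at hf
  exact subsingleton_of_zero_eq_one hf

theorem toOp_mem_stabilization_of_extension (hH : ¬ FiniteDimensional ℂ H) {T : TorsionedQDS B m}
    (hT : suspensionHom m ξ.proj T = 0) : TorsionedQDS.toOp B m T ∈ stabilization B := by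
  rcases subsingleton_or_nontrivial A with hA | hA
  · have hB := subsingleton_of_subsingleton ξ hH
    have h0 : TorsionedQDS.toOp B m T = 0 := op_ext fun i j => by
      obtain ⟨b, hb⟩ := exists_entry_eq T i j
      rw [← hb, Subsingleton.elim b 0, map_zero, map_zero]
    rw [h0]
    exact zero_mem _
  · exact toOp_mem_stabilization hT

/-- The kernel of `Σ²_m α` acts by elements of `C(Y) ⊗ K(H) ⊗ K(ℓ²(ℕ))`: its elements are limits of
finite matrices over the ideal. -/
theorem exists_toMult_eq_suspensionMult (hH : ¬ FiniteDimensional ℂ H) {T : TorsionedQDS B m}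
    (hT : suspensionHom m ξ.proj T = 0) :
    ∃ F : CptFun Y (Seq H), toMult F = suspensionMult m ξ.multiplier T := by
  choose f hf using exists_entry_eq_incl ξ hT
  have hlim : Filter.Tendsto (fun n => ∑ i ∈ Finset.range n, ∑ j ∈ Finset.range n,
      qdsUnit m (ξ.incl (f i j)) i j) Filter.atTop (nhds T) := by
    rw [isometry_toOp.isEmbedding.tendsto_nhds_iff]
    refine (tendsto_trunc_of_mem_stabilization
      (toOp_mem_stabilization_of_extension ξ hH hT)).congr fun n => ?_
    rw [trunc_mul_mul_trunc]
    simp only [Function.comp_apply, map_sum, toOp_qdsUnit, hf]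
  refine (isClosed_suspensionMult_mem_range ξ.multiplier).mem_of_tendsto hlim
    (Filter.Eventually.of_forall fun n => ?_)
  refine ⟨∑ i ∈ Finset.range n, ∑ j ∈ Finset.range n, (f i j).tensor i j, ?_⟩
  simp only [map_sum, suspensionMult_qdsUnit_incl]

end Suspension

/-! ### The suspended extension -/

section Suspension

variable {m : ℤ} (ξ : CStarExtension (CptFun Y H) B A)

variable (m) in
/-- The kernel of `Σ²_m α` acts on `C(Y) ⊗ K(H) ⊗ K(ℓ²(ℕ))` by multipliers. -/
def kerToMult : StarKer (suspensionHom m ξ.proj) →⋆ₙₐ[ℂ] Mult Y (Seq H) where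
  toFun T := suspensionMult m ξ.multiplier (starKerIncl _ T)
  map_smul' c T := by rw [map_smul, map_smul]; rfl
  map_zero' := by rw [map_zero, map_zero]
  map_add' T T' := by rw [map_add, map_add]
  map_mul' T T' := by rw [map_mul, map_mul]
  map_star' T := by rw [map_star, map_star]

variable (m) in
/-- The action of the kernel of `Σ²_m α`, with values in `C(Y) ⊗ K(H) ⊗ K(ℓ²(ℕ))`. -/
def kerToCptFun (hH : ¬ FiniteDimensional ℂ H) :
    StarKer (suspensionHom m ξ.proj) →⋆ₙₐ[ℂ] CptFun Y (Seq H) :=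
  factorThrough toMult toMult_injective (kerToMult m ξ)
    fun T => exists_toMult_eq_suspensionMult ξ hH (apply_starKerIncl _ T)

theorem toMult_kerToCptFun (hH : ¬ FiniteDimensional ℂ H)
    (T : StarKer (suspensionHom m ξ.proj)) : toMult (kerToCptFun m ξ hH T) =
      suspensionMult m ξ.multiplier (starKerIncl _ T) :=
  apply_factorThrough toMult toMult_injective (kerToMult m ξ) _ T

theorem kerToCptFun_injective (hH : ¬ FiniteDimensional ℂ H) :
    Function.Injective (kerToCptFun m ξ hH) := by
  rw [injective_iff_map_eq_zero]
  intro T hT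
  have h1 := toMult_kerToCptFun ξ hH T
  rw [hT, map_zero] at h1
  refine starKerIncl_injective _ ?_
  rw [eq_zero_of_suspensionMult_eq_zero ξ (apply_starKerIncl _ T) h1.symm, map_zero]

theorem tensor_mem_range_kerToCptFun (hH : ¬ FiniteDimensional ℂ H) (f : CptFun Y H) (i j : ℕ) :
    ∃ T, kerToCptFun m ξ hH T = f.tensor i j ∧ starKerIncl _ T = qdsUnit m (ξ.incl f) i j := by
  obtain ⟨T, hT⟩ := exists_starKerIncl_eq (suspensionHom_qdsUnit_incl ξ (m := m) f i j)
  refine ⟨T, toMult_injective ?_, hT⟩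
  rw [toMult_kerToCptFun, hT, suspensionMult_qdsUnit_incl]

/-- The range is closed, since an injective *-homomorphism is isometric, and contains the finite
matrices over `C(Y) ⊗ K(H)`, which are dense. -/
theorem kerToCptFun_surjective (hH : ¬ FiniteDimensional ℂ H) :
    Function.Surjective (kerToCptFun m ξ hH) := by
  intro F
  have hcl : IsClosed (Set.range (kerToCptFun m ξ hH)) :=
    (NonUnitalStarAlgHom.isometry (kerToCptFun m ξ hH)
      (kerToCptFun_injective ξ hH)).isClosedEmbedding.isClosed_range
  refine hcl.mem_of_tendsto F.tendsto_sum_entry_tensor (Filter.Eventually.of_forall fun n => ?_)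
  choose T hT _ using fun i j => tensor_mem_range_kerToCptFun ξ (m := m) hH (F.entry i j) i j
  refine ⟨∑ i ∈ Finset.range n, ∑ j ∈ Finset.range n, T i j, ?_⟩
  simp only [map_sum, hT]

variable (m) in
/-- The inverse of `kerToCptFun`. -/
def cptFunToKer (hH : ¬ FiniteDimensional ℂ H) :
    CptFun Y (Seq H) →⋆ₙₐ[ℂ] StarKer (suspensionHom m ξ.proj) :=
  factorThrough (kerToCptFun m ξ hH) (kerToCptFun_injective ξ hH) (NonUnitalStarAlgHom.id ℂ _)
    (kerToCptFun_surjective ξ hH)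

theorem kerToCptFun_cptFunToKer (hH : ¬ FiniteDimensional ℂ H) (F : CptFun Y (Seq H)) :
    kerToCptFun m ξ hH (cptFunToKer m ξ hH F) = F :=
  apply_factorThrough _ (kerToCptFun_injective ξ hH) _ _ F

theorem cptFunToKer_kerToCptFun (hH : ¬ FiniteDimensional ℂ H)
    (T : StarKer (suspensionHom m ξ.proj)) : cptFunToKer m ξ hH (kerToCptFun m ξ hH T) = T :=
  kerToCptFun_injective ξ hH (kerToCptFun_cptFunToKer ξ hH _)

variable (m) in
/-- The suspended extension `Σ²_m ξ`. The ideal `C(Y) ⊗ K(H) ⊗ K(ℓ²(ℕ))` is identified with the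
kernel of `Σ²_m α` through its action as multipliers. -/
def suspensionExtension (hH : ¬ FiniteDimensional ℂ H) :
    CStarExtension (CptFun Y (Seq H)) (TorsionedQDS B m) (TorsionedQDS A m) where
  incl := (starKerIncl (suspensionHom m ξ.proj)).comp (cptFunToKer m ξ hH)
  proj := suspensionHom m ξ.proj
  incl_injective := (starKerIncl_injective _).comp
    (Function.LeftInverse.injective (kerToCptFun_cptFunToKer ξ hH))
  proj_surjective := suspensionHom_surjective ξ.proj ξ.proj_surjective
  proj_eq_zero_iff T := by
    refine ⟨fun hT => ?_, ?_⟩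
    · obtain ⟨z, rfl⟩ := exists_starKerIncl_eq hT
      exact ⟨kerToCptFun m ξ hH z, congrArg (starKerIncl _) (cptFunToKer_kerToCptFun ξ hH z)⟩
    · rintro ⟨F, rfl⟩
      exact apply_starKerIncl _ _

theorem suspensionExtension_incl (hH : ¬ FiniteDimensional ℂ H)
    (T : StarKer (suspensionHom m ξ.proj)) :
    (suspensionExtension m ξ hH).incl (kerToCptFun m ξ hH T) = starKerIncl _ T :=
  congrArg (starKerIncl _) (cptFunToKer_kerToCptFun ξ hH T)

theorem suspensionMult_incl (hH : ¬ FiniteDimensional ℂ H) (F : CptFun Y (Seq H)) :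
    suspensionMult m ξ.multiplier ((suspensionExtension m ξ hH).incl F) = toMult F := by
  obtain ⟨T, rfl⟩ := kerToCptFun_surjective ξ (m := m) hH F
  rw [suspensionExtension_incl, toMult_kerToCptFun]

/-- `suspensionMult m ξ.multiplier T` is the multiplier by which `T` acts on the ideal. -/
theorem suspensionExtension_multiplier (hH : ¬ FiniteDimensional ℂ H) (T : TorsionedQDS B m) :
    (suspensionExtension m ξ hH).multiplier T = suspensionMult m ξ.multiplier T := by
  refine ((suspensionExtension m ξ hH).eq_multiplierFun fun F K h => ?_).symm
  rw [← suspensionMult_incl ξ (m := m) hH K, h, map_mul, suspensionMult_incl]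

/-- The Busby invariant of the suspended extension is induced by `suspensionMult`. -/
theorem suspensionExtension_busby (hH : ¬ FiniteDimensional ℂ H) (T : TorsionedQDS B m) :
    (suspensionExtension m ξ hH).busby (suspensionHom m ξ.proj T) =
      toCorona (suspensionMult m ξ.multiplier T) := by
  rw [← suspensionExtension_multiplier ξ hH]
  exact (suspensionExtension m ξ hH).busby_proj T

theorem isSuspensionInvariant_busby (hH : ¬ FiniteDimensional ℂ H) :
    IsSuspensionInvariant m ξ.busby (suspensionExtension m ξ hH).busby := by
  refine ⟨fun a i j => ?_, ?_⟩
  · obtain ⟨b, rfl⟩ := ξ.proj_surjective a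
    rw [← suspensionHom_qdsUnit, suspensionExtension_busby, suspensionMult_qdsUnit, ξ.busby_proj,
      coronaTensor_toCorona]
  · rw [← suspensionHom_qdsShift ξ.proj, suspensionExtension_busby, suspensionMult_qdsShift]

theorem isHomogeneous_suspensionExtension (hH : ¬ FiniteDimensional ℂ H) (h : ξ.IsHomogeneous) :
    (suspensionExtension m ξ hH).IsHomogeneous := by
  intro y
  have key : ∀ x, evCorona y ((suspensionExtension m ξ hH).busby x) = 0 → x = 0 := by
    intro x hx
    obtain ⟨T, rfl⟩ := suspensionHom_surjective (m := m) ξ.proj ξ.proj_surjective x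
    rw [suspensionExtension_busby, evCorona_toCorona] at hx
    have hc : IsCompactOperator ((suspensionMult m ξ.multiplier T : Y → Seq H →L[ℂ] Seq H) y) :=
      Ideal.Quotient.eq_zero_iff_mem.1 hx
    refine toOp_injective (op_ext fun i j => ?_)
    obtain ⟨b, hb⟩ := exists_entry_eq T i j
    have h1 : IsCompactOperator ((ξ.multiplier b : Y → H →L[ℂ] H) y) := by
      rw [← entry_suspensionMult ξ.multiplier hb y]
      exact (hc.comp_clm (lp.singleContinuousLinearMap ℂ (fun _ : ℕ => H) 2 j)).clm_comp
        (lp.evalCLM ℂ (fun _ : ℕ => H) 2 i)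
    have h2 : evCorona y (ξ.busby (ξ.proj b)) = 0 := by
      rw [ξ.busby_proj, evCorona_toCorona]
      exact Ideal.Quotient.eq_zero_iff_mem.2 h1
    have h3 : ξ.proj b = 0 := h y (by simp only [h2, map_zero])
    rw [entry_suspensionHom ξ.proj hb, h3, map_zero, map_zero, map_zero]
  intro x x' hxx
  rw [← sub_eq_zero]
  refine key _ ?_
  rw [map_sub, map_sub]
  exact sub_eq_zero.2 hxx

end Suspension

end QDS

end

theorem mainTheorem6 {Y : Type*} [TopologicalSpace Y] [CompactSpace Y] [T2Space Y]
    {H : Type*} [NormedAddCommGroup H] [InnerProductSpace ℂ H] [CompleteSpace H]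
    [TopologicalSpace.SeparableSpace H] (hH : ¬ FiniteDimensional ℂ H)
    {A B : Type*} [CStarAlgebra A] [CStarAlgebra B]
    (ξ : QDS.CStarExtension (QDS.CptFun Y H) B A) (m : ℤ) (hm : m ≠ 0) :
    ∃ Ξ : QDS.CStarExtension (QDS.CptFun Y (QDS.Seq H))
        (QDS.TorsionedQDS B m) (QDS.TorsionedQDS A m),
      (∀ f i j, Ξ.incl (f.tensor i j) = QDS.qdsUnit m (ξ.incl f) i j) ∧
      QDS.IsSuspensionHom m ξ.proj Ξ.proj ∧
      QDS.IsSuspensionInvariant m ξ.busby Ξ.busby ∧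
      (ξ.IsHomogeneous → Ξ.IsHomogeneous) := by
  refine ⟨QDS.suspensionExtension m ξ hH, fun f i j => ?_,
    QDS.isSuspensionHom_suspensionHom ξ.proj, QDS.isSuspensionInvariant_busby ξ hH,
    QDS.isHomogeneous_suspensionExtension ξ hH⟩
  obtain ⟨T, hT, hT'⟩ := QDS.tensor_mem_range_kerToCptFun ξ (m := m) hH f i j
  rw [← hT, QDS.suspensionExtension_incl, hT']
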